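/- Let $G$ be a finite, nonempty simple graph with an edge-coloring $C : E(G)\to\mathbb{N}$ (not necessarily proper). For a vertex $v$, let the color degree $d^c(v)$ be the number of distinct colors appearing on the edges incident with $v$. Let $k\ge 7$ be an integer and suppose that $d^c(v)\ge k$ for every vertex $v$ of $G$. Then $G$ contains a heterochromatic (rainbow) path, that is, a path any two distinct edges of which have different colors, of length (number of edges) at least $\lceil 2k/3\rceil+1$. -/

import Mathlib

namespace SimpleGraph

variable {V : Type*} {G : SimpleGraph V}

/-- The color neighborhood `CN(v)`: the set of colors of the edges incident with `v`. -/
def EdgeLabeling.colorNeighborhood (C : G.EdgeLabeling ℕ) (v : V) : Set ℕ :=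
  {c | ∃ e : G.edgeSet, v ∈ (e : Sym2 V) ∧ C e = c}

/-- The color degree `d^c(v) = |CN(v)|` (used for finite graphs, where `CN(v)` is finite). -/
noncomputable def EdgeLabeling.colorDegree (C : G.EdgeLabeling ℕ) (v : V) : ℕ :=
  (C.colorNeighborhood v).ncard

/-- A walk (in particular, a path) is heterochromatic, or rainbow, if any two distinct edges
of it have different colors. -/
def EdgeLabeling.IsHeterochromatic (C : G.EdgeLabeling ℕ) {u v : V} (p : G.Walk u v) : Prop :=
  ∀ e f : G.edgeSet, (e : Sym2 V) ∈ p.edges → (f : Sym2 V) ∈ p.edges → e ≠ f → C e ≠ C f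

end SimpleGraph

/-!
Let `l` be the length of a longest rainbow path, suppose that `l ≤ ⌈2 * k / 3⌉`, and put
`d = k - l`. Then `2 ≤ d`, `l ≤ 2 * d + 2`, and every vertex sees at least `l + d` colors
(`ShortRainbow`). Every contradiction below comes from a rainbow path with more than `l` edges that
is put together from pieces of a given path or cycle, joined by edges of new colors, that is, of
colors that the path or cycle does not use.

*There is no rainbow cycle of length `l + 1`* (`RainbowCycle.no_cycle`). An edge that leaves such a
cycle has one of its colors, as the cycle could be opened and extended otherwise. Hence every vertex
off the cycle has at least `d - 1` new colors leading to vertices that are off the cycle too, and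
starts a rainbow path of about `d / 2` edges there. Thus, if an edge from `u r` out of the cycle has
the color of the step that is `j` steps away, then `j` lies in a window of about `d` values, of
which at least `d` occur. On the other hand every vertex of the cycle has at least `d - 1` new
chords. At a suitable vertex the short ones are excluded by `RainbowCycle.not_skip`, and each long
one removes a value from the window of a neighbor of this vertex on the cycle. For `3 ≤ d` this is
too much. For `d = 2` the cycle has six or seven vertices, and a look at the chords suffices
(`RainbowCycle.false_of_two`). It follows that a new color at an end of a longest rainbow path
always leads to an inner vertex of the path.

*There is a path of length `l + 1` on which only the first and the last edge have equal colors*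
(`IndexedPath.exists_twinPath`). If there is none, then counting the colors at the two ends of a
longest rainbow path gives `l = 2 * d + 2` and shows that the ends are adjacent, by an edge whose
color occurs in the second half of the path. Applied to the reversed path, this is a contradiction.

*Such a twin path `v 0, …, v (l + 1)` cannot exist* (`TwinPath.false_of_shortRainbow`). Dropping
either end leaves a longest rainbow path. As an end cannot be inserted between two consecutive inner
vertices, its new neighbors hit each block `{2 * j, 2 * j + 1}`, `1 ≤ j ≤ d`, in exactly one color,
so it sees exactly `d` new colors and therefore all the colors of the path. But the new neighbors of
`v (l + 1)` exclude all of these, except the color of the first step and at most two others, from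
the edges that join `v 0` to `v l` or to vertices off the path. The excluded colors must come from
`v (l + 1)` and from the one vertex of each block that is not a new neighbor. This forces `d = 2`
and `l = 6`, where a single configuration survives, and it contains a rainbow path of length seven.
-/

section

open SimpleGraph

variable {V : Type*} {G : SimpleGraph V} {c : Sym2 V → ℕ}

/-! ### Rainbow paths -/

/-- There is a rainbow path from `u` to `w` with `n` edges, all of whose vertices lie in `S` and all
of whose colors lie in `K`. The colors are given by a total function on unordered pairs, of which
only the values on edges of `G` matter. -/
def RainbowReach (G : SimpleGraph V) (c : Sym2 V → ℕ) (u w : V) (S : Set V) (K : Set ℕ)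
    (n : ℕ) : Prop :=
  ∃ p : G.Walk u w, p.support.Nodup ∧ (p.edges.map c).Nodup ∧ (∀ x ∈ p.support, x ∈ S) ∧
    (∀ e ∈ p.edges, c e ∈ K) ∧ p.length = n

namespace RainbowReach

variable {u w w' z : V} {S S' : Set V} {K K' : Set ℕ} {m n : ℕ}

theorem refl (u : V) : RainbowReach G c u u {u} ∅ 0 :=
  ⟨Walk.nil, by simp⟩

theorem mono (h : RainbowReach G c u w S K n) (hS : S ⊆ S') (hK : K ⊆ K') :
    RainbowReach G c u w S' K' n := by
  obtain ⟨p, h1, h2, h3, h4, h5⟩ := h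
  exact ⟨p, h1, h2, fun x hx => hS (h3 x hx), fun e he => hK (h4 e he), h5⟩

theorem symm (h : RainbowReach G c u w S K n) : RainbowReach G c w u S K n := by
  obtain ⟨p, h1, h2, h3, h4, h5⟩ := h
  refine ⟨p.reverse, ?_, ?_, ?_, ?_, by simpa using h5⟩
  · simpa using h1
  · rw [Walk.edges_reverse, List.map_reverse]; exact List.nodup_reverse.2 h2
  · simpa using h3
  · simpa using h4

/-- Two rainbow paths with disjoint vertices and disjoint colors, joined by an edge of a further
color, form a rainbow path. -/
theorem join (h : RainbowReach G c u w S K m) (h' : RainbowReach G c w' z S' K' n)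
    (hadj : G.Adj w w') (hS : ∀ x ∈ S, x ∉ S') (hK : ∀ x ∈ K, x ∉ K')
    (h1 : c s(w, w') ∉ K) (h2 : c s(w, w') ∉ K') :
    RainbowReach G c u z (S ∪ S') (insert (c s(w, w')) (K ∪ K')) (m + n + 1) := by
  obtain ⟨p, p1, p2, p3, p4, p5⟩ := h
  obtain ⟨q, q1, q2, q3, q4, q5⟩ := h'
  refine ⟨p.append (Walk.cons hadj q), ?_, ?_, ?_, ?_, ?_⟩
  · rw [Walk.support_append, Walk.support_cons, List.tail_cons, List.nodup_append]
    refine ⟨p1, q1, ?_⟩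
    rintro a ha b hb rfl
    exact hS a (p3 a ha) (q3 a hb)
  · rw [Walk.edges_append, Walk.edges_cons, List.map_append, List.map_cons, List.nodup_append]
    refine ⟨p2, ?_, ?_⟩
    · rw [List.nodup_cons]
      refine ⟨?_, q2⟩
      intro hm
      obtain ⟨e, he, hee⟩ := List.mem_map.1 hm
      exact h2 (hee ▸ q4 e he)
    · intro a ha b hb hab
      subst hab
      obtain ⟨e, he, rfl⟩ := List.mem_map.1 ha
      rcases List.mem_cons.1 hb with hb | hb
      · exact h1 (hb ▸ p4 e he)
      · obtain ⟨f, hf, hfe⟩ := List.mem_map.1 hb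
        exact hK _ (p4 e he) (hfe ▸ q4 f hf)
  · intro x hx
    rw [Walk.support_append, Walk.support_cons, List.tail_cons, List.mem_append] at hx
    exact hx.imp (p3 x) (q3 x)
  · intro e he
    rw [Walk.edges_append, Walk.edges_cons, List.mem_append, List.mem_cons] at he
    rcases he with he | rfl | he
    · exact Or.inr (Or.inl (p4 e he))
    · exact Or.inl rfl
    · exact Or.inr (Or.inr (q4 e he))
  · simp [Walk.length_append, p5, q5]; omega

theorem cons (h : RainbowReach G c u w S K n) {x : V} (hadj : G.Adj x u) (hx : x ∉ S)
    (hc : c s(x, u) ∉ K) :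
    RainbowReach G c x w (insert x S) (insert (c s(x, u)) K) (n + 1) := by
  have := (refl (G := G) (c := c) x).join h hadj (by simpa using hx) (by simp) (by simp) hc
  exact (by simpa using this)

end RainbowReach

/-- The vertices `v 0, …, v m` are distinct, and the consecutive ones `v i, v (i + 1)` with
`lo ≤ i < hi` are joined by edges of distinct colors. -/
structure IndexedPath (G : SimpleGraph V) (c : Sym2 V → ℕ) (v : ℕ → V) (m lo hi : ℕ) : Prop where
  inj : ∀ i ≤ m, ∀ j ≤ m, v i = v j → i = j
  hi_le : hi ≤ m
  adj : ∀ i, lo ≤ i → i < hi → G.Adj (v i) (v (i + 1))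
  col : ∀ i j, lo ≤ i → i < hi → lo ≤ j → j < hi →
    c s(v i, v (i + 1)) = c s(v j, v (j + 1)) → i = j

namespace IndexedPath

variable {v : ℕ → V} {m lo hi : ℕ}

theorem run_up (h : IndexedPath G c v m lo hi) (a n : ℕ) (hlo : n = 0 ∨ lo ≤ a)
    (hhi : n = 0 ∨ a + n ≤ hi) (ham : a ≤ m) :
    RainbowReach G c (v a) (v (a + n)) {x | ∃ i, a ≤ i ∧ i ≤ a + n ∧ x = v i}
      {γ | ∃ i, a ≤ i ∧ i < a + n ∧ γ = c s(v i, v (i + 1))} n := by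
  induction n generalizing a with
  | zero =>
    refine (RainbowReach.refl (v a)).mono ?_ (by simp)
    rintro x rfl
    exact ⟨a, le_rfl, le_rfl, rfl⟩
  | succ n ih =>
    have hl : lo ≤ a := by omega
    have hh : a + (n + 1) ≤ hi := by omega
    have hm := h.hi_le
    have key := (ih (a + 1) (by omega) (by omega) (by omega)).cons (h.adj a hl (by omega)) ?_ ?_
    · rw [show a + 1 + n = a + (n + 1) by ring] at key
      refine key.mono ?_ ?_
      · rintro x (rfl | ⟨i, h1, h2, rfl⟩)
        · exact ⟨a, by omega, by omega, rfl⟩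
        · exact ⟨i, by omega, by omega, rfl⟩
      · rintro x (rfl | ⟨i, h1, h2, rfl⟩)
        · exact ⟨a, by omega, by omega, rfl⟩
        · exact ⟨i, by omega, by omega, rfl⟩
    · rintro ⟨i, h1, h2, h3⟩
      have := h.inj a (by omega) i (by omega) h3
      omega
    · rintro ⟨i, h1, h2, h3⟩
      have := h.col a i hl (by omega) (by omega) (by omega) h3
      omega

/-- The part of an indexed path between two indices `a` and `b`, in either direction; `p ≤ q` are
the smaller and the larger of the two. -/
theorem run (h : IndexedPath G c v m lo hi) {a b p q : ℕ}
    (o : (a = p ∧ b = q) ∨ (a = q ∧ b = p)) (hpq : p ≤ q) (r : q ≤ p ∨ (lo ≤ p ∧ q ≤ hi))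
    (hq : q ≤ m) :
    RainbowReach G c (v a) (v b) {x | ∃ i, (p ≤ i ∧ i ≤ q) ∧ x = v i}
      {γ | ∃ i, (p ≤ i ∧ i < q) ∧ γ = c s(v i, v (i + 1))} (q - p) := by
  have := h.run_up p (q - p) (by omega) (by omega) (by omega)
  rw [show p + (q - p) = q by omega] at this
  rcases o with ⟨rfl, rfl⟩ | ⟨rfl, rfl⟩
  · simpa [and_assoc] using this
  · simpa [and_assoc] using this.symm

/-- Two disjoint runs of an indexed path, joined by a chord whose color they do not use. -/
theorem two_runs (h : IndexedPath G c v m lo hi) {a₁ b₁ p₁ q₁ a₂ b₂ p₂ q₂ : ℕ}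
    (o₁ : (a₁ = p₁ ∧ b₁ = q₁) ∨ (a₁ = q₁ ∧ b₁ = p₁))
    (o₂ : (a₂ = p₂ ∧ b₂ = q₂) ∨ (a₂ = q₂ ∧ b₂ = p₂))
    (r₁ : p₁ ≤ q₁ ∧ q₁ ≤ m ∧ (q₁ ≤ p₁ ∨ (lo ≤ p₁ ∧ q₁ ≤ hi)))
    (r₂ : p₂ ≤ q₂ ∧ q₂ ≤ m ∧ (q₂ ≤ p₂ ∨ (lo ≤ p₂ ∧ q₂ ≤ hi)))
    (d₁₂ : q₁ < p₂ ∨ q₂ < p₁)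
    (adj₁ : G.Adj (v b₁) (v a₂))
    (f₁ : ∀ i, lo ≤ i → i < hi → ((p₁ ≤ i ∧ i < q₁) ∨ (p₂ ≤ i ∧ i < q₂)) →
      c s(v b₁, v a₂) ≠ c s(v i, v (i + 1))) :
    RainbowReach G c (v a₁) (v b₂)
      {x | ∃ i, ((p₁ ≤ i ∧ i ≤ q₁) ∨ (p₂ ≤ i ∧ i ≤ q₂)) ∧ x = v i}
      {γ | γ = c s(v b₁, v a₂) ∨ ∃ i, ((p₁ ≤ i ∧ i < q₁) ∨ (p₂ ≤ i ∧ i < q₂)) ∧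
          γ = c s(v i, v (i + 1))}
      ((q₁ - p₁) + (q₂ - p₂) + 1) := by
  refine ((h.run o₁ (by omega) (by omega) (by omega)).join
    (h.run o₂ (by omega) (by omega) (by omega)) adj₁ ?_ ?_ ?_ ?_).mono ?_ ?_
  · rintro x ⟨i, hi, rfl⟩ ⟨j, hj, hij⟩
    have := h.inj i (by omega) j (by omega) hij
    omega
  · rintro x ⟨i, hi, rfl⟩ ⟨j, hj, hij⟩
    have := h.col i j (by omega) (by omega) (by omega) (by omega) hij
    omega
  · rintro ⟨i, hi, hc⟩
    exact f₁ i (by omega) (by omega) (Or.inl hi) hc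
  · rintro ⟨i, hi, hc⟩
    exact f₁ i (by omega) (by omega) (Or.inr hi) hc
  · rintro x (⟨i, hi, rfl⟩ | ⟨i, hi, rfl⟩)
    · exact ⟨i, Or.inl hi, rfl⟩
    · exact ⟨i, Or.inr hi, rfl⟩
  · rintro x (rfl | ⟨i, hi, rfl⟩ | ⟨i, hi, rfl⟩)
    · exact Or.inl rfl
    · exact Or.inr ⟨i, Or.inl hi, rfl⟩
    · exact Or.inr ⟨i, Or.inr hi, rfl⟩

/-- Three disjoint runs of an indexed path, joined by two chords of distinct colors that the runs
do not use. -/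
theorem three_runs (h : IndexedPath G c v m lo hi) {a₁ b₁ p₁ q₁ a₂ b₂ p₂ q₂ a₃ b₃ p₃ q₃ : ℕ}
    (o₁ : (a₁ = p₁ ∧ b₁ = q₁) ∨ (a₁ = q₁ ∧ b₁ = p₁))
    (o₂ : (a₂ = p₂ ∧ b₂ = q₂) ∨ (a₂ = q₂ ∧ b₂ = p₂))
    (o₃ : (a₃ = p₃ ∧ b₃ = q₃) ∨ (a₃ = q₃ ∧ b₃ = p₃))
    (r₁ : p₁ ≤ q₁ ∧ q₁ ≤ m ∧ (q₁ ≤ p₁ ∨ (lo ≤ p₁ ∧ q₁ ≤ hi)))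
    (r₂ : p₂ ≤ q₂ ∧ q₂ ≤ m ∧ (q₂ ≤ p₂ ∨ (lo ≤ p₂ ∧ q₂ ≤ hi)))
    (r₃ : p₃ ≤ q₃ ∧ q₃ ≤ m ∧ (q₃ ≤ p₃ ∨ (lo ≤ p₃ ∧ q₃ ≤ hi)))
    (d₁₂ : q₁ < p₂ ∨ q₂ < p₁) (d₁₃ : q₁ < p₃ ∨ q₃ < p₁) (d₂₃ : q₂ < p₃ ∨ q₃ < p₂)
    (adj₁ : G.Adj (v b₁) (v a₂)) (adj₂ : G.Adj (v b₂) (v a₃))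
    (hne : c s(v b₁, v a₂) ≠ c s(v b₂, v a₃))
    (f₁ : ∀ i, lo ≤ i → i < hi →
      ((p₁ ≤ i ∧ i < q₁) ∨ (p₂ ≤ i ∧ i < q₂) ∨ (p₃ ≤ i ∧ i < q₃)) →
      c s(v b₁, v a₂) ≠ c s(v i, v (i + 1)))
    (f₂ : ∀ i, lo ≤ i → i < hi →
      ((p₁ ≤ i ∧ i < q₁) ∨ (p₂ ≤ i ∧ i < q₂) ∨ (p₃ ≤ i ∧ i < q₃)) →
      c s(v b₂, v a₃) ≠ c s(v i, v (i + 1))) :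
    RainbowReach G c (v a₁) (v b₃)
      {x | ∃ i, ((p₁ ≤ i ∧ i ≤ q₁) ∨ (p₂ ≤ i ∧ i ≤ q₂) ∨ (p₃ ≤ i ∧ i ≤ q₃)) ∧ x = v i}
      {γ | γ = c s(v b₁, v a₂) ∨ γ = c s(v b₂, v a₃) ∨ ∃ i,
        ((p₁ ≤ i ∧ i < q₁) ∨ (p₂ ≤ i ∧ i < q₂) ∨ (p₃ ≤ i ∧ i < q₃)) ∧
          γ = c s(v i, v (i + 1))}
      ((q₁ - p₁) + (q₂ - p₂) + (q₃ - p₃) + 2) := by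
  have key := (h.two_runs o₁ o₂ r₁ r₂ d₁₂ adj₁
      (fun i h1 h2 h3 => f₁ i h1 h2 (h3.imp_right Or.inl))).join
    (h.run o₃ (by omega) (by omega) (by omega)) adj₂ ?_ ?_ ?_ ?_
  · rw [show ∀ p q r : ℕ, p + q + 1 + r + 1 = p + q + r + 2 by intros; ring] at key
    refine key.mono ?_ ?_
    · rintro x (⟨i, hi, rfl⟩ | ⟨i, hi, rfl⟩)
      · exact ⟨i, hi.imp_right Or.inl, rfl⟩
      · exact ⟨i, Or.inr (Or.inr hi), rfl⟩
    · rintro x (rfl | (rfl | ⟨i, hi, rfl⟩) | ⟨i, hi, rfl⟩)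
      · exact Or.inr (Or.inl rfl)
      · exact Or.inl rfl
      · exact Or.inr (Or.inr ⟨i, hi.imp_right Or.inl, rfl⟩)
      · exact Or.inr (Or.inr ⟨i, Or.inr (Or.inr hi), rfl⟩)
  · clear o₁ o₂ o₃
    rintro x ⟨i, hi | hi, rfl⟩ ⟨j, hj, hij⟩ <;>
    · have := h.inj i (by omega) j (by omega) hij
      omega
  · clear o₁ o₂ o₃
    rintro x (rfl | ⟨i, hi | hi, rfl⟩) ⟨j, hj, hij⟩
    · exact f₁ j (by omega) (by omega) (Or.inr (Or.inr hj)) hij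
    all_goals
      have := h.col i j (by omega) (by omega) (by omega) (by omega) hij
      omega
  · rintro (hh | ⟨i, hi, hc⟩)
    · exact hne hh.symm
    · clear o₁ o₂ o₃
      exact f₂ i (by omega) (by omega) (hi.imp_right Or.inl) hc
  · clear o₁ o₂ o₃
    rintro ⟨i, hi, hc⟩
    exact f₂ i (by omega) (by omega) (Or.inr (Or.inr hi)) hc

end IndexedPath

/-- No rainbow path is longer than `l`, although every vertex sees at least `l + d` colors, where
`2 ≤ d` and `l ≤ 2 * d + 2`. -/
structure ShortRainbow (G : SimpleGraph V) (c : Sym2 V → ℕ) (l d : ℕ) : Prop where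
  max : ∀ u w S K n, RainbowReach G c u w S K n → n ≤ l
  deg : ∀ v, ∃ D : Finset ℕ, l + d ≤ D.card ∧ ∀ γ ∈ D, ∃ w, G.Adj v w ∧ c s(v, w) = γ
  two_le : 2 ≤ d
  le : l ≤ 2 * d + 2

theorem ShortRainbow.false_of_edge {l d : ℕ} (H : ShortRainbow G c l d) {u z w : V} {S : Set V}
    {K : Set ℕ} (h : RainbowReach G c u z S K l) (hadj : G.Adj u w) (hw : w ∉ S)
    (hc : c s(u, w) ∉ K) : False := by
  have := H.max _ _ _ _ _ (h.cons hadj.symm hw (by rwa [Sym2.eq_swap]))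
  omega

/-! ### Longest rainbow paths do not close up to rainbow cycles -/

/-- A rainbow cycle of length `l + 1`, as a periodic sequence of vertices. -/
structure RainbowCycle (G : SimpleGraph V) (c : Sym2 V → ℕ) (u : ℤ → V) (l : ℕ) : Prop where
  per : Function.Periodic u ((l : ℤ) + 1)
  inj : ∀ i j, u i = u j → (l : ℤ) + 1 ∣ j - i
  adj : ∀ i, G.Adj (u i) (u (i + 1))
  col : ∀ i j, c s(u i, u (i + 1)) = c s(u j, u (j + 1)) → (l : ℤ) + 1 ∣ j - i

/-- The color `γ` does not occur between consecutive vertices of `u`. -/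
def NewColor (c : Sym2 V → ℕ) (u : ℤ → V) (γ : ℕ) : Prop :=
  ∀ i, γ ≠ c s(u i, u (i + 1))

/-- The vertex `w` does not lie on `u`. -/
def Off (u : ℤ → V) (w : V) : Prop := ∀ i, w ≠ u i

/-- The vertices `u r` and `u s` are joined by an edge of a color that `u` does not use. -/
def NewChord (G : SimpleGraph V) (c : Sym2 V → ℕ) (u : ℤ → V) (r s : ℤ) : Prop :=
  G.Adj (u r) (u s) ∧ NewColor c u (c s(u r, u s))

/-- The vertex `u r` has a neighbor off `u` along an edge of the color that is found `j` steps
further on `u`. -/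
def Leaves (G : SimpleGraph V) (c : Sym2 V → ℕ) (u : ℤ → V) (r : ℤ) (j : ℕ) : Prop :=
  ∃ w, Off u w ∧ G.Adj (u r) w ∧ c s(u r, w) = c s(u (r + j), u (r + j + 1))

theorem NewChord.symm {u : ℤ → V} {r s : ℤ} (h : NewChord G c u r s) : NewChord G c u s r :=
  ⟨h.1.symm, by rw [Sym2.eq_swap]; exact h.2⟩

namespace RainbowCycle

variable {u : ℤ → V} {l d : ℕ}

theorem eq_add_one (h : RainbowCycle G c u l) {i j : ℤ} (hij : i = j + (l + 1)) : u i = u j := by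
  rw [hij]; exact h.per j

/-- Starting from any `u r`, every step of the cycle is reached within one turn. -/
theorem exists_index (h : RainbowCycle G c u l) (r i : ℤ) :
    ∃ k : ℕ, k ≤ l ∧ u i = u (r + k) ∧ u (i + 1) = u (r + k + 1) := by
  have h1 := Int.emod_nonneg (i - r) (show (l : ℤ) + 1 ≠ 0 by omega)
  have h2 := Int.emod_lt_of_pos (i - r) (show (0 : ℤ) < (l : ℤ) + 1 by omega)
  have h3 := Int.emod_add_mul_ediv (i - r) ((l : ℤ) + 1)
  have h4 := h.per.int_mul ((i - r) / ((l : ℤ) + 1))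
  obtain ⟨k, hk⟩ := Int.eq_ofNat_of_zero_le h1
  rw [hk] at h2 h3
  refine ⟨k, by omega, ?_, ?_⟩
  · rw [← h4 (r + k)]
    congr 1
    linear_combination -h3
  · rw [← h4 (r + k + 1)]
    congr 1
    linear_combination -h3

theorem eq_of_dvd {a b : ℤ} (hdvd : (l : ℤ) + 1 ∣ b - a) (h1 : a ≤ b + l) (h2 : b ≤ a + l) :
    a = b := by
  have := Int.eq_zero_of_abs_lt_dvd hdvd (abs_lt.2 ⟨by omega, by omega⟩)
  omega

/-- The rainbow path left when the edge that enters `u r` is removed. -/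
theorem path (h : RainbowCycle G c u l) (r : ℤ) :
    IndexedPath G c (fun k : ℕ => u (r + k)) l 0 l where
  inj i hi j hj he := by
    have := eq_of_dvd (h.inj _ _ he) (by omega) (by omega)
    omega
  hi_le := le_rfl
  adj i _ _ := by
    have := h.adj (r + i)
    rwa [add_assoc] at this
  col i j _ hi _ hj he := by
    push_cast at he
    rw [← add_assoc, ← add_assoc] at he
    have := eq_of_dvd (h.col _ _ he) (by omega) (by omega)
    omega

theorem reflect (h : RainbowCycle G c u l) : RainbowCycle G c (fun i => u (-i)) l where
  per i := (h.eq_add_one (by ring)).symm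
  inj i j he := by
    have := h.inj _ _ he
    rwa [show -j - -i = -(j - i) by ring, dvd_neg] at this
  adj i := by
    have := (h.adj (-(i + 1))).symm
    rwa [show -(i + 1) + 1 = -i by ring] at this
  col i j he := by
    have key : ∀ i, s(u (-i), u (-(i + 1))) = s(u (-(i + 1)), u (-(i + 1) + 1)) := fun i => by
      rw [Sym2.eq_swap, show -(i + 1) + 1 = -i by ring]
    rw [key, key] at he
    have := h.col _ _ he
    rwa [show -(j + 1) - -(i + 1) = -(j - i) by ring, dvd_neg] at this

theorem newColor_reflect {γ : ℕ} (hγ : NewColor c u γ) : NewColor c (fun i => u (-i)) γ := by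
  intro i he
  refine hγ (-(i + 1)) (he.trans ?_)
  rw [Sym2.eq_swap, show -(i + 1) + 1 = -i by ring]

/-- In the reflected cycle, the step `u (r + j), u (r + j + 1)` lies `l - j` steps from `u r`. -/
theorem leaves_reflect (h : RainbowCycle G c u l) {r : ℤ} {j : ℕ} (hj : j ≤ l)
    (ho : Leaves G c u r j) : Leaves G c (fun i => u (-i)) (-r) (l - j) := by
  obtain ⟨w, hw, hadj, hc⟩ := ho
  refine ⟨w, fun i => hw (-i), by simpa using hadj, ?_⟩
  beta_reduce
  rw [neg_neg, hc, Sym2.eq_swap, h.eq_add_one (i := r + j + 1) (j := -(-r + ((l - j : ℕ) : ℤ))),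
    h.eq_add_one (i := r + j) (j := -(-r + ((l - j : ℕ) : ℤ) + 1))] <;>
  · push_cast [hj]
    ring

/-- An edge that leaves the cycle has a color of the cycle. -/
theorem not_newColor_of_off (h : RainbowCycle G c u l) (H : ShortRainbow G c l d) {r : ℤ} {w : V}
    (hw : Off u w) (hadj : G.Adj (u r) w) : ¬ NewColor c u (c s(u r, w)) := by
  intro hnew
  have hr := (h.path r).run (a := 0) (b := l) (p := 0) (q := l) (by omega) (by omega) (by omega)
    (by omega)
  simp only [Nat.sub_zero, Nat.cast_zero, add_zero] at hr
  refine H.false_of_edge hr hadj ?_ ?_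
  · rintro ⟨i, -, he⟩
    exact hw _ he
  · rintro ⟨i, -, he⟩
    push_cast at he
    rw [← add_assoc] at he
    exact hnew _ he

/-- The colors seen by a vertex, except those of the cycle. -/
theorem exists_newColors (H : ShortRainbow G c l d) (h : RainbowCycle G c u l) (z : V) :
    ∃ D : Finset ℕ, d - 1 ≤ D.card ∧
      ∀ γ ∈ D, NewColor c u γ ∧ ∃ w, G.Adj z w ∧ c s(z, w) = γ := by
  classical
  obtain ⟨D, hD, hDw⟩ := H.deg z
  set E : Finset ℕ := (Finset.range (l + 1)).image
    fun k : ℕ => c s(u (0 + k), u (0 + k + 1)) with hE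
  have hEc : E.card ≤ l + 1 := Finset.card_image_le.trans_eq (Finset.card_range _)
  have h1 := Finset.le_card_sdiff E D
  refine ⟨D \ E, by omega, fun γ hγ => ⟨fun i hi => ?_, hDw γ (Finset.mem_sdiff.1 hγ).1⟩⟩
  obtain ⟨k, hk, e1, e2⟩ := h.exists_index 0 i
  rw [e1, e2] at hi
  exact (Finset.mem_sdiff.1 hγ).2 (Finset.mem_image.2 ⟨k, by rw [Finset.mem_range]; omega, hi.symm⟩)

/-- Every vertex off the cycle ends a rainbow path off the cycle with new colors; it is built
greedily from `w`, and its length is about half the number `d - 1` of available colors. -/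
theorem exists_off_path (h : RainbowCycle G c u l) (H : ShortRainbow G c l d) {w : V}
    (hw : Off u w) (F : Finset ℕ) (m : ℕ) (hm : 2 * m + F.card ≤ d + 1)
    (hm' : m = 0 ∨ m + F.card + 1 ≤ d) :
    ∃ z, RainbowReach G c z w {x | Off u x} {γ | NewColor c u γ ∧ γ ∉ F} m := by
  classical
  induction m with
  | zero =>
    exact ⟨w, (RainbowReach.refl w).mono (by simpa using hw) (by simp)⟩
  | succ m ih =>
    obtain ⟨z, p, p1, p2, p3, p4, p5⟩ := ih (by omega) (by omega)
    obtain ⟨D, hD, hDw⟩ := exists_newColors H h z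
    -- colors of the path built so far, and colors that lead back to it
    obtain ⟨B, hB, hB1, hB2⟩ : ∃ B : Finset ℕ, B.card + F.card < d - 1 ∧
        (∀ e ∈ p.edges, c e ∈ B) ∧ ∀ x ∈ p.support, G.Adj z x → c s(z, x) ∈ B := by
      cases p with
      | nil =>
        rw [Walk.length_nil] at p5
        refine ⟨∅, by rw [Finset.card_empty]; omega, by simp, ?_⟩
        intro x hx hadj
        rw [Walk.support_nil, List.mem_singleton] at hx
        exact absurd hx hadj.ne'
      | @cons _ b _ hzb q =>
        rw [Walk.length_cons] at p5
        refine ⟨(q.edges.map c).toFinset ∪ q.support.toFinset.image fun x => c s(z, x), ?_, ?_, ?_⟩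
        · have h1 := Finset.card_union_le (q.edges.map c).toFinset
            (q.support.toFinset.image fun x => c s(z, x))
          have h2 := (q.edges.map c).toFinset_card_le
          have h3 := Finset.card_image_le (s := q.support.toFinset) (f := fun x => c s(z, x))
          have h4 := q.support.toFinset_card_le
          rw [List.length_map, Walk.length_edges] at h2
          rw [Walk.length_support] at h4
          omega
        · intro e he
          rw [Walk.edges_cons, List.mem_cons] at he
          rcases he with rfl | he
          · exact Finset.mem_union_right _ (Finset.mem_image.2
              ⟨b, List.mem_toFinset.2 q.start_mem_support, rfl⟩)
          · exact Finset.mem_union_left _ (List.mem_toFinset.2 (List.mem_map_of_mem he))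
        · intro x hx hadj
          rw [Walk.support_cons, List.mem_cons] at hx
          rcases hx with rfl | hx
          · exact absurd rfl hadj.ne
          · exact Finset.mem_union_right _ (Finset.mem_image.2 ⟨x, List.mem_toFinset.2 hx, rfl⟩)
    obtain ⟨γ, hγ, hγB⟩ : ∃ γ ∈ D, γ ∉ B ∪ F := by
      refine Finset.exists_mem_notMem_of_card_lt_card ?_
      have := Finset.card_union_le B F
      omega
    rw [Finset.mem_union, not_or] at hγB
    obtain ⟨hnew, y, hadj, rfl⟩ := hDw γ hγ
    have hz := p3 z p.start_mem_support
    have hy : Off u y := by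
      rintro i rfl
      refine h.not_newColor_of_off H hz hadj.symm ?_
      rwa [Sym2.eq_swap]
    have hp : RainbowReach G c z w {x | x ∈ p.support} {γ | ∃ e ∈ p.edges, c e = γ} m :=
      ⟨p, p1, p2, fun x hx => hx, fun e he => ⟨e, he, rfl⟩, p5⟩
    refine ⟨y, (hp.cons hadj.symm ?_ ?_).mono ?_ ?_⟩
    · exact fun hys => hγB.1 (hB2 y hys hadj)
    · rintro ⟨e, he, hec⟩
      rw [Sym2.eq_swap] at hec
      exact hγB.1 (hec ▸ hB1 e he)
    · rintro x (rfl | hx)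
      · exact hy
      · exact p3 x hx
    · rintro x (rfl | ⟨e, he, rfl⟩)
      · rw [Sym2.eq_swap]
        exact ⟨hnew, hγB.2⟩
      · exact p4 e he

/-- A rainbow path through the cycle, preceded by an edge that leaves the cycle and by a path off
the cycle. -/
theorem length_le_of_leaves (h : RainbowCycle G c u l) (H : ShortRainbow G c l d) {r : ℤ}
    {j m t : ℕ} {F : Finset ℕ} (hm : 2 * m + F.card ≤ d + 1) (hm' : m = 0 ∨ m + F.card + 1 ≤ d)
    (ho : Leaves G c u r j) {y : V} {S : Set V} {K : Set ℕ} (hR : RainbowReach G c (u r) y S K t)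
    (hS : ∀ x ∈ S, ∃ i, x = u i) (hK : ∀ γ ∈ K, ¬ NewColor c u γ ∨ γ ∈ F)
    (hj : c s(u (r + j), u (r + j + 1)) ∉ K) : m + t + 1 ≤ l := by
  obtain ⟨w, hw, hadj, hc⟩ := ho
  obtain ⟨z, hz⟩ := h.exists_off_path H hw F m hm hm'
  have hc' : c s(w, u r) = c s(u (r + j), u (r + j + 1)) := by rw [Sym2.eq_swap, hc]
  refine H.max _ _ _ _ _ (hz.join hR hadj.symm ?_ ?_ ?_ ?_)
  · rintro x hx hxS
    obtain ⟨i, rfl⟩ := hS x hxS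
    exact hx i rfl
  · rintro γ ⟨h1, h2⟩ hγ
    rcases hK γ hγ with h3 | h3
    · exact h3 h1
    · exact h2 h3
  · rw [hc']
    exact fun hn => hn.1 _ rfl
  · rwa [hc']

theorem not_newColor (u : ℤ → V) (i : ℤ) : ¬ NewColor c u (c s(u i, u (i + 1))) :=
  fun hn => hn i rfl

/-- Going around the cycle from `u r` up to the step whose color is used to leave the cycle, and
continuing off the cycle, gives a rainbow path; it has at most `l` edges. -/
theorem leaves_add_lt (h : RainbowCycle G c u l) (H : ShortRainbow G c l d) {r : ℤ} {j m : ℕ}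
    (hm : 2 * m ≤ d + 1) (hjl : j ≤ l) (ho : Leaves G c u r j) : m + j + 1 ≤ l := by
  have hd := H.two_le
  have hr := (h.path r).run (a := 0) (b := j) (p := 0) (q := j) (by omega) (by omega) (by omega)
    (by omega)
  simp only [Nat.sub_zero, Nat.cast_zero, add_zero] at hr
  refine h.length_le_of_leaves H (F := ∅) (by simpa using hm) (by rw [Finset.card_empty]; omega) ho
    hr ?_ ?_ ?_
  · rintro x ⟨i, -, rfl⟩
    exact ⟨_, rfl⟩
  · rintro γ ⟨i, -, rfl⟩
    left
    have := not_newColor (c := c) u (r + i)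
    rwa [add_assoc] at this
  · rintro ⟨i, hi, he⟩
    push_cast at he
    rw [← add_assoc] at he
    have := eq_of_dvd (h.col _ _ he) (by omega) (by omega)
    omega

theorem leaves_bounds (h : RainbowCycle G c u l) (H : ShortRainbow G c l d) {r : ℤ} {j m : ℕ}
    (hm : 2 * m ≤ d + 1) (hjl : j ≤ l) (ho : Leaves G c u r j) :
    m + 1 ≤ j ∧ m + j + 1 ≤ l := by
  have h1 := h.leaves_add_lt H hm hjl ho
  have h2 := h.reflect.leaves_add_lt H hm (by omega) (h.leaves_reflect hjl ho)
  omega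

/-- A chord that skips a few vertices behind the removed step `j` is made up for by the path off
the cycle. -/
theorem not_skip (h : RainbowCycle G c u l) (H : ShortRainbow G c l d) {r : ℤ} {j m D : ℕ}
    (hm : 2 * m ≤ d) (hm' : m = 0 ∨ m + 2 ≤ d) (ho : Leaves G c u r j) (hD : 1 ≤ D)
    (hDm : D ≤ m + 1) (hjD : j + D ≤ l) (hn : NewChord G c u (r + j) (r + j + D)) : False := by
  have hnew : ∀ i : ℕ,
      c s(u (r + j), u (r + (j + D : ℕ))) ≠ c s(u (r + i), u (r + (i + 1 : ℕ))) := by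
    intro i
    push_cast
    rw [← add_assoc, ← add_assoc]
    exact hn.2 (r + i)
  have hr := (h.path r).two_runs (a₁ := 0) (b₁ := j) (p₁ := 0) (q₁ := j) (a₂ := j + D) (b₂ := l)
    (p₂ := j + D) (q₂ := l) (by omega) (by omega) (by omega) (by omega) (by omega)
    (by push_cast; rw [← add_assoc]; exact hn.1) (fun i _ _ _ => hnew i)
  simp only [Nat.sub_zero, Nat.cast_zero, add_zero] at hr
  have := h.length_le_of_leaves H (F := {c s(u (r + j), u (r + (j + D : ℕ)))}) (m := m)
    (by rw [Finset.card_singleton]; omega) (by rw [Finset.card_singleton]; omega) ho hr ?_ ?_ ?_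
  · omega
  · rintro x ⟨i, -, rfl⟩
    exact ⟨_, rfl⟩
  · rintro γ (rfl | ⟨i, -, rfl⟩)
    · exact Or.inr (Finset.mem_singleton_self _)
    · left
      have := not_newColor (c := c) u (r + i)
      rwa [add_assoc] at this
  · rintro (he | ⟨i, hi, he⟩)
    · have := hnew j
      push_cast at he this
      rw [add_assoc] at he
      exact this he.symm
    · push_cast at he
      rw [← add_assoc] at he
      have := eq_of_dvd (h.col _ _ he) (by omega) (by omega)
      omega

/-- The mirror image of `not_skip`. -/
theorem not_skip' (h : RainbowCycle G c u l) (H : ShortRainbow G c l d) {r : ℤ} {j m D : ℕ}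
    (hm : 2 * m ≤ d) (hm' : m = 0 ∨ m + 2 ≤ d) (ho : Leaves G c u r j) (hD : 1 ≤ D)
    (hDm : D ≤ m + 1) (hDj : D ≤ j) (hjl : j ≤ l)
    (hn : NewChord G c u (r + j + 1) (r + j + 1 - D)) : False := by
  refine h.reflect.not_skip H hm hm' (h.leaves_reflect hjl ho) hD hDm (by omega) ?_
  have e1 : u (r + j + 1) = u (-(-r + ((l - j : ℕ) : ℤ))) :=
    h.eq_add_one (by push_cast [hjl]; ring)
  have e2 : u (r + j + 1 - D) = u (-(-r + ((l - j : ℕ) : ℤ) + D)) :=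
    h.eq_add_one (by push_cast [hjl]; ring)
  unfold NewChord at hn ⊢
  rw [e1, e2] at hn
  exact ⟨hn.1, newColor_reflect hn.2⟩

/-- A new chord from the predecessor of `u r` to the start of the removed step gives a path through
the whole cycle. -/
theorem not_chord (h : RainbowCycle G c u l) (H : ShortRainbow G c l d) {r : ℤ} {j : ℕ}
    (hjl : j < l) (ho : Leaves G c u r j) (hn : NewChord G c u (r + l) (r + j)) : False := by
  replace hn := hn.symm
  have hnew : ∀ i : ℕ, c s(u (r + j), u (r + l)) ≠ c s(u (r + i), u (r + (i + 1 : ℕ))) := by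
    intro i
    push_cast
    rw [← add_assoc]
    exact hn.2 (r + i)
  have hr := (h.path r).two_runs (a₁ := 0) (b₁ := j) (p₁ := 0) (q₁ := j) (a₂ := l) (b₂ := j + 1)
    (p₂ := j + 1) (q₂ := l) (by omega) (by omega) (by omega) (by omega) (by omega)
    hn.1 (fun i _ _ _ => hnew i)
  simp only [Nat.sub_zero, Nat.cast_zero, add_zero] at hr
  have := h.length_le_of_leaves H (F := {c s(u (r + j), u (r + l))}) (m := 0)
    (by rw [Finset.card_singleton]; omega) (Or.inl rfl) ho hr ?_ ?_ ?_
  · omega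
  · rintro x ⟨i, -, rfl⟩
    exact ⟨_, rfl⟩
  · rintro γ (rfl | ⟨i, -, rfl⟩)
    · exact Or.inr (Finset.mem_singleton_self _)
    · left
      have := not_newColor (c := c) u (r + i)
      rwa [add_assoc] at this
  · rintro (he | ⟨i, hi, he⟩)
    · exact hn.2 _ he.symm
    · push_cast at he
      rw [← add_assoc] at he
      have := eq_of_dvd (h.col _ _ he) (by omega) (by omega)
      omega

/-- The mirror image of `not_chord`. -/
theorem not_chord' (h : RainbowCycle G c u l) (H : ShortRainbow G c l d) {r : ℤ} {j : ℕ}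
    (hj : 1 ≤ j) (hjl : j ≤ l) (ho : Leaves G c u r j)
    (hn : NewChord G c u (r + 1) (r + j + 1)) : False := by
  refine h.reflect.not_chord H (by omega : l - j < l) (h.leaves_reflect hjl ho) ?_
  have e1 : u (r + 1) = u (-(-r + l)) := h.eq_add_one (by ring)
  have e2 : u (r + j + 1) = u (-(-r + ((l - j : ℕ) : ℤ))) :=
    h.eq_add_one (by push_cast [hjl]; ring)
  unfold NewChord at hn ⊢
  rw [e1, e2] at hn
  exact ⟨hn.1, newColor_reflect hn.2⟩

open Classical in
/-- The steps, counted from `u r`, whose colors occur on edges that leave the cycle at `u r`. -/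
noncomputable def leaving (G : SimpleGraph V) (c : Sym2 V → ℕ) (u : ℤ → V) (l : ℕ) (r : ℤ) :
    Finset ℕ := (Finset.range (l + 1)).filter fun j => Leaves G c u r j

open Classical in
/-- The distances, counted from `u r`, of the ends of new chords at `u r`. -/
noncomputable def chords (G : SimpleGraph V) (c : Sym2 V → ℕ) (u : ℤ → V) (l : ℕ) (r : ℤ) :
    Finset ℕ := (Finset.range (l + 1)).filter fun k => NewChord G c u r (r + k)

theorem mem_leaving {r : ℤ} {j : ℕ} : j ∈ leaving G c u l r ↔ j ≤ l ∧ Leaves G c u r j := by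
  simp only [leaving, Finset.mem_filter, Finset.mem_range, Nat.lt_succ_iff]

theorem mem_chords {r : ℤ} {k : ℕ} :
    k ∈ chords G c u l r ↔ k ≤ l ∧ NewChord G c u r (r + k) := by
  simp only [chords, Finset.mem_filter, Finset.mem_range, Nat.lt_succ_iff]

/-- At most `l` of the `l + d` colors at `u r` are on edges to the `l` other vertices of the cycle.
-/
theorem le_card_leaving (h : RainbowCycle G c u l) (H : ShortRainbow G c l d) (r : ℤ) :
    d ≤ (leaving G c u l r).card := by
  classical
  obtain ⟨D, hD, hDw⟩ := H.deg (u r)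
  set A := (Finset.range l).image fun k : ℕ => c s(u r, u (r + k + 1)) with hA
  set B := (leaving G c u l r).image fun j : ℕ => c s(u (r + j), u (r + j + 1)) with hB
  have hAc : A.card ≤ l := Finset.card_image_le.trans_eq (Finset.card_range _)
  have hBc : B.card ≤ (leaving G c u l r).card := Finset.card_image_le
  have hsub : D ⊆ A ∪ B := by
    intro γ hγ
    obtain ⟨w, hadj, rfl⟩ := hDw γ hγ
    by_cases hw : Off u w
    · have hn := h.not_newColor_of_off H hw hadj
      unfold NewColor at hn
      push Not at hn
      obtain ⟨i, hi⟩ := hn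
      obtain ⟨k, hk, e1, e2⟩ := h.exists_index r i
      rw [e1, e2] at hi
      exact Finset.mem_union_right _ (Finset.mem_image.2
        ⟨k, mem_leaving.2 ⟨hk, w, hw, hadj, hi⟩, hi.symm⟩)
    · unfold Off at hw
      push Not at hw
      obtain ⟨i, rfl⟩ := hw
      obtain ⟨k, hk, e1, -⟩ := h.exists_index r i
      have hk0 : k ≠ 0 := by
        rintro rfl
        rw [Nat.cast_zero, add_zero] at e1
        exact hadj.ne e1.symm
      refine Finset.mem_union_left _ (Finset.mem_image.2 ⟨k - 1, ?_, ?_⟩)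
      · rw [Finset.mem_range]; omega
      · rw [e1, show r + ((k - 1 : ℕ) : ℤ) + 1 = r + k by omega]
  have h1 := Finset.card_le_card hsub
  have h2 := Finset.card_union_le A B
  omega

theorem le_card_chords (h : RainbowCycle G c u l) (H : ShortRainbow G c l d) (r : ℤ) :
    d - 1 ≤ (chords G c u l r).card := by
  classical
  obtain ⟨D, hD, hDw⟩ := exists_newColors H h (u r)
  have hsub : D ⊆ (chords G c u l r).image fun k : ℕ => c s(u r, u (r + k)) := by
    intro γ hγ
    obtain ⟨hnew, w, hadj, rfl⟩ := hDw γ hγ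
    by_cases hw : Off u w
    · exact absurd hnew (h.not_newColor_of_off H hw hadj)
    · unfold Off at hw
      push Not at hw
      obtain ⟨i, rfl⟩ := hw
      obtain ⟨k, hk, e1, -⟩ := h.exists_index r i
      rw [e1] at hadj hnew ⊢
      exact Finset.mem_image.2 ⟨k, mem_chords.2 ⟨hk, hadj, hnew⟩, rfl⟩
  have h1 := Finset.card_le_card hsub
  have h2 := Finset.card_image_le (s := chords G c u l r) (f := fun k : ℕ => c s(u r, u (r + k)))
  omega

theorem bounds_of_mem_chords (h : RainbowCycle G c u l) {r : ℤ} {k : ℕ}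
    (hk : k ∈ chords G c u l r) : 2 ≤ k ∧ k + 1 ≤ l := by
  obtain ⟨hkl, hadj, hnew⟩ := mem_chords.1 hk
  have h0 : k ≠ 0 := by
    rintro rfl
    rw [Nat.cast_zero, add_zero] at hadj
    exact hadj.ne rfl
  have h1 : k ≠ 1 := by
    rintro rfl
    exact hnew r rfl
  have h2 : k ≠ l := by
    rintro rfl
    have e : u (r - 1 + 1) = u r := by rw [sub_add_cancel]
    have e' : u (r + k) = u (r - 1) := h.eq_add_one (by ring)
    have := hnew (r - 1)
    rw [e, e', Sym2.eq_swap] at this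
    exact this rfl
  omega

theorem bounds_of_mem_leaving (h : RainbowCycle G c u l) (H : ShortRainbow G c l d) {r : ℤ}
    {j m : ℕ} (hm : 2 * m ≤ d + 1) (hj : j ∈ leaving G c u l r) : m + 1 ≤ j ∧ m + j + 1 ≤ l := by
  obtain ⟨h1, h2⟩ := mem_leaving.1 hj
  exact h.leaves_bounds H hm h1 h2

/-- `not_chord'`, read from the end `u y` of the chord. -/
theorem notMem_leaving_pred (h : RainbowCycle G c u l) (H : ShortRainbow G c l d) {y : ℤ} {k : ℕ}
    (hk : k ∈ chords G c u l y) : k ∉ leaving G c u l (y - 1) := by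
  intro hj
  have hb := h.bounds_of_mem_chords hk
  have hn := (mem_chords.1 hk).2
  refine h.not_chord' H (by omega) (by omega) (mem_leaving.1 hj).2 ?_
  rwa [show y - 1 + 1 = y by ring, show y - 1 + k + 1 = y + k by ring]

/-- `not_chord`, read from the end `u y` of the chord. -/
theorem notMem_leaving_succ (h : RainbowCycle G c u l) (H : ShortRainbow G c l d) {y : ℤ} {k : ℕ}
    (hk : k + 1 ∈ chords G c u l y) : k ∉ leaving G c u l (y + 1) := by
  intro hj
  have hb := h.bounds_of_mem_chords hk
  obtain ⟨-, hadj, hnew⟩ := mem_chords.1 hk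
  have e : u (y + 1 + l) = u y := h.eq_add_one (by ring)
  refine h.not_chord H (by omega) (mem_leaving.1 hj).2 ?_
  unfold NewChord
  push_cast at hadj hnew
  rw [e, show y + 1 + (k : ℤ) = y + (k + 1) by ring]
  exact ⟨hadj, hnew⟩

/-- If the colors of two consecutive steps occur on edges that leave the cycle at `u 0`, then the
vertex between these steps has long new chords only. -/
theorem chords_bounds (h : RainbowCycle G c u l) (H : ShortRainbow G c l d) (hd : 3 ≤ d) {y : ℕ}
    (hy : y ∈ leaving G c u l 0) (hy' : y + 1 ∈ leaving G c u l 0) {k : ℕ}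
    (hk : k ∈ chords G c u l (y + 1 : ℕ)) : d / 2 + 2 ≤ k ∧ k + d / 2 + 1 ≤ l := by
  have hb := h.bounds_of_mem_chords hk
  have hn := (mem_chords.1 hk).2
  obtain ⟨y1, y2⟩ := h.bounds_of_mem_leaving H (m := (d + 1) / 2) (by omega) hy
  obtain ⟨y3, y4⟩ := h.bounds_of_mem_leaving H (m := (d + 1) / 2) (by omega) hy'
  constructor
  · by_contra hcon
    refine h.not_skip H (m := d / 2) (D := k) (by omega) (by omega) (mem_leaving.1 hy').2 (by omega)
      (by omega) (by omega) ?_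
    rwa [zero_add]
  · by_contra hcon
    refine h.not_skip' H (m := d / 2) (D := l + 1 - k) (by omega) (by omega) (mem_leaving.1 hy).2
      (by omega) (by omega) (by omega) (by omega) ?_
    have e : u ((y + 1 : ℕ) + k) = u (0 + y + 1 - ((l + 1 - k : ℕ) : ℤ)) :=
      h.eq_add_one (by omega)
    unfold NewChord at hn ⊢
    rw [e] at hn
    simpa using hn

theorem false_of_three_le (h : RainbowCycle G c u l) (H : ShortRainbow G c l d) (hd : 3 ≤ d) :
    False := by
  classical
  have hle := H.le
  set m := (d + 1) / 2 with hm
  have window : ∀ r, leaving G c u l r ⊆ Finset.Icc (m + 1) (l - m - 1) := by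
    intro r j hj
    have := h.bounds_of_mem_leaving H (m := m) (by omega) hj
    rw [Finset.mem_Icc]
    omega
  have hcard := h.le_card_leaving H
  have hwin : (Finset.Icc (m + 1) (l - m - 1)).card ≤ 2 * d + 1 - 2 * m := by
    rw [Nat.card_Icc]
    omega
  -- the window is too short for `d` elements without two consecutive ones
  obtain ⟨y, hy, hy'⟩ : ∃ y ∈ leaving G c u l 0, y + 1 ∈ leaving G c u l 0 := by
    by_contra hcon
    push Not at hcon
    have hdisj : Disjoint (leaving G c u l 0) ((leaving G c u l 0).image (· + 1)) := by
      rw [Finset.disjoint_right]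
      intro j hj hj'
      obtain ⟨i, hi, rfl⟩ := Finset.mem_image.1 hj
      exact hcon i hi hj'
    have hsub : leaving G c u l 0 ∪ (leaving G c u l 0).image (· + 1) ⊆
        Finset.Icc (m + 1) (l - m) := by
      intro j hj
      rw [Finset.mem_Icc]
      rcases Finset.mem_union.1 hj with hj | hj
      · have := h.bounds_of_mem_leaving H (m := m) (by omega) hj
        omega
      · obtain ⟨i, hi, rfl⟩ := Finset.mem_image.1 hj
        have := h.bounds_of_mem_leaving H (m := m) (by omega) hi
        omega
    have h1 := Finset.card_le_card hsub
    rw [Finset.card_union_of_disjoint hdisj, Finset.card_image_of_injective _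
      (add_left_injective 1), Nat.card_Icc] at h1
    have := hcard 0
    omega
  have hy1 := h.bounds_of_mem_leaving H (m := m) (by omega) hy
  set z : ℤ := ((y + 1 : ℕ) : ℤ) with hz
  have hN := h.le_card_chords H z
  have hNb : ∀ k ∈ chords G c u l z, d / 2 + 2 ≤ k ∧ k + d / 2 + 1 ≤ l :=
    fun k hk => h.chords_bounds H hd hy hy' hk
  rcases Nat.even_or_odd' d with ⟨e, he | he⟩
  · have hsub : leaving G c u l (z - 1) ∪ chords G c u l z ⊆ Finset.Icc (m + 1) (l - m - 1) := by
      refine Finset.union_subset (window _) fun k hk => ?_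
      have := hNb k hk
      rw [Finset.mem_Icc]
      omega
    have hdisj : Disjoint (leaving G c u l (z - 1)) (chords G c u l z) := by
      rw [Finset.disjoint_right]
      exact fun k hk => h.notMem_leaving_pred H hk
    have h1 := Finset.card_le_card hsub
    rw [Finset.card_union_of_disjoint hdisj] at h1
    have := hcard (z - 1)
    omega
  · have heq : ∀ r, leaving G c u l r = Finset.Icc (m + 1) (l - m - 1) := fun r =>
      Finset.eq_of_subset_of_card_le (window r) (by have := hcard r; omega)
    obtain ⟨k, hk⟩ : (chords G c u l z).Nonempty := Finset.card_pos.1 (by omega)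
    have hkb := hNb k hk
    have h1 := h.notMem_leaving_pred H hk
    rw [heq, Finset.mem_Icc] at h1
    obtain ⟨k', rfl⟩ : ∃ k', k = k' + 1 := ⟨k - 1, by omega⟩
    have h2 := h.notMem_leaving_succ H hk
    rw [heq, Finset.mem_Icc] at h2
    omega

/-- The chords of a cycle of seven vertices that skip one vertex (`a`) or two vertices (`b`). -/
theorem false_of_periodic_seven {a b : ℤ → Prop} (ha : Function.Periodic a 7)
    (hb : Function.Periodic b 7)
    (h₂₃ : ∀ r, ¬ ((b (r - 1) ∨ a (r + 1)) ∧ (b (r + 3) ∨ b (r + 1))))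
    (h₂₄ : ∀ r, ¬ ((b (r - 1) ∨ a (r + 1)) ∧ (a (r + 4) ∨ b (r + 5))))
    (h₃₄ : ∀ r, ¬ ((b (r + 3) ∨ b (r + 1)) ∧ (a (r + 4) ∨ b (r + 5))))
    (hex : ∀ y, a y ∨ b y ∨ b (y + 4) ∨ a (y + 5)) : False := by
  have hnb : ∀ j, ¬ b j := by
    intro j hj
    rcases hex (j + 5) with h | h | h | h
    · refine h₂₄ (j + 1) ⟨Or.inl ?_, Or.inl ?_⟩
      · rwa [show j + 1 - 1 = j by ring]
      · rwa [show j + 1 + 4 = j + 5 by ring]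
    · refine h₃₄ (j + 2) ⟨Or.inl ?_, Or.inr ?_⟩
      · rwa [show j + 2 + 3 = j + 5 by ring]
      · rwa [show j + 2 + 5 = j + 7 by ring, hb]
    · rw [show j + 5 + 4 = j + 2 + 7 by ring, hb] at h
      refine h₂₃ (j + 1) ⟨Or.inl ?_, Or.inr ?_⟩
      · rwa [show j + 1 - 1 = j by ring]
      · rwa [show j + 1 + 1 = j + 2 by ring]
    · rw [show j + 5 + 5 = j + 3 + 7 by ring, ha] at h
      refine h₃₄ (j - 1) ⟨Or.inr ?_, Or.inl ?_⟩
      · rwa [sub_add_cancel]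
      · rwa [show j - 1 + 4 = j + 3 by ring]
  have hna : ∀ j, a j → ¬ a (j + 3) := by
    intro j hj hj'
    refine h₂₄ (j - 1) ⟨Or.inr ?_, Or.inl ?_⟩
    · rwa [sub_add_cancel]
    · rwa [show j - 1 + 4 = j + 3 by ring]
  have hsucc : ∀ j, a j → a (j + 1) := by
    intro j hj
    rcases hex (j + 3) with h | h | h | h
    · exact absurd h (hna j hj)
    · exact absurd h (hnb _)
    · exact absurd h (hnb _)
    · rwa [show j + 3 + 5 = j + 1 + 7 by ring, ha] at h
  have hall : ∃ j, a j := by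
    rcases hex 0 with h | h | h | h
    · exact ⟨_, h⟩
    · exact absurd h (hnb _)
    · exact absurd h (hnb _)
    · exact ⟨_, h⟩
  obtain ⟨j, hj⟩ := hall
  refine hna j hj ?_
  have := hsucc _ (hsucc _ (hsucc _ hj))
  rwa [show j + 1 + 1 + 1 = j + 3 by ring] at this

/-- Indices may be reduced modulo `l + 1`. -/
theorem newChord_congr (h : RainbowCycle G c u l) {r r' s s' : ℤ} (hr : r = r' ∨ r = r' + (l + 1))
    (hs : s = s' ∨ s = s' + (l + 1)) : NewChord G c u r s ↔ NewChord G c u r' s' := by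
  have e1 : u r = u r' := by
    rcases hr with rfl | hr
    · rfl
    · exact h.eq_add_one hr
  have e2 : u s = u s' := by
    rcases hs with rfl | hs
    · rfl
    · exact h.eq_add_one hs
  unfold NewChord
  rw [e1, e2]

theorem false_of_two (h : RainbowCycle G c u l) (H : ShortRainbow G c l 2) : False := by
  classical
  have hle := H.le
  have hcard := h.le_card_leaving H
  have hb : ∀ r, ∀ j ∈ leaving G c u l r, 2 ≤ j ∧ j + 2 ≤ l := by
    intro r j hj
    have := h.bounds_of_mem_leaving H (m := 1) (by omega) hj
    omega
  have window : ∀ r, leaving G c u l r ⊆ Finset.Icc 2 (l - 2) := by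
    intro r j hj
    have := hb r j hj
    rw [Finset.mem_Icc]
    omega
  have hch : ∀ y, ∃ k, k ∈ chords G c u l y := fun y =>
    Finset.card_pos.1 (by have := h.le_card_chords H y; omega)
  have hl : l = 5 ∨ l = 6 := by
    have h1 := (hcard 0).trans (Finset.card_le_card (window 0))
    rw [Nat.card_Icc] at h1
    omega
  rcases hl with rfl | rfl
  · have heq : ∀ r, leaving G c u 5 r = Finset.Icc 2 3 := fun r =>
      Finset.eq_of_subset_of_card_le (window r) (hcard r)
    obtain ⟨k, hk⟩ := hch 0
    have hkb := h.bounds_of_mem_chords hk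
    have h1 := h.notMem_leaving_pred H hk
    rw [heq, Finset.mem_Icc] at h1
    obtain rfl : k = 3 + 1 := by omega
    have h2 := h.notMem_leaving_succ H hk
    rw [heq, Finset.mem_Icc] at h2
    omega
  · -- of the three steps in the window, at most one is missing
    have two : ∀ r i j k, ({i, j, k} : Finset ℕ) = Finset.Icc 2 4 → i ∉ leaving G c u 6 r →
        j ∉ leaving G c u 6 r → False := by
      intro r i j k hijk hi hj
      have hsub : leaving G c u 6 r ⊆ {k} := by
        intro x hx
        have hx' := window r hx
        rw [show 6 - 2 = 4 from rfl, ← hijk] at hx'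
        simp only [Finset.mem_insert, Finset.mem_singleton] at hx' ⊢
        rcases hx' with rfl | rfl | rfl
        · exact absurd hx hi
        · exact absurd hx hj
        · rfl
      have h1 := Finset.card_le_card hsub
      have h2 := hcard r
      rw [Finset.card_singleton] at h1
      omega
    have pred : ∀ (r : ℤ) (k : ℕ), k ≤ 6 → NewChord G c u (r + 1) (r + 1 + k) →
        k ∉ leaving G c u 6 r := by
      intro r k hk hn
      have := h.notMem_leaving_pred H (mem_chords.2 ⟨hk, hn⟩)
      rwa [add_sub_cancel_right] at this
    have succ : ∀ (r : ℤ) (k : ℕ), k + 1 ≤ 6 → NewChord G c u (r - 1) (r + k) →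
        k ∉ leaving G c u 6 r := by
      intro r k hk hn
      rw [show r + (k : ℤ) = r - 1 + (k + 1 : ℕ) by push_cast; ring] at hn
      have := h.notMem_leaving_succ H (mem_chords.2 ⟨hk, hn⟩)
      rwa [sub_add_cancel] at this
    have congr : ∀ {r s} (r' s'), (r = r' ∨ r = r' + 7) → (s = s' ∨ s = s' + 7) →
        NewChord G c u r s → NewChord G c u r' s' :=
      fun {r s} r' s' hr hs hn =>
        (h.newChord_congr (by push_cast; omega) (by push_cast; omega)).1 hn
    have k2 : ∀ r, NewChord G c u (r - 1) (r - 1 + 3) ∨ NewChord G c u (r + 1) (r + 1 + 2) →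
        2 ∉ leaving G c u 6 r := by
      rintro r (hn | hn)
      · exact succ r 2 (by omega) (congr _ _ (by omega) (by push_cast; omega) hn)
      · exact pred r 2 (by omega) hn
    have k3 : ∀ r, NewChord G c u (r + 3) (r + 3 + 3) ∨ NewChord G c u (r + 1) (r + 1 + 3) →
        3 ∉ leaving G c u 6 r := by
      rintro r (hn | hn)
      · exact succ r 3 (by omega) (congr _ _ (by omega) (by push_cast; omega) hn.symm)
      · exact pred r 3 (by omega) hn
    have k4 : ∀ r, NewChord G c u (r + 4) (r + 4 + 2) ∨ NewChord G c u (r + 5) (r + 5 + 3) →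
        4 ∉ leaving G c u 6 r := by
      rintro r (hn | hn)
      · exact succ r 4 (by omega) (congr _ _ (by omega) (by push_cast; omega) hn.symm)
      · exact pred r 4 (by omega) (congr _ _ (by omega) (by push_cast; omega) hn.symm)
    refine false_of_periodic_seven (a := fun i => NewChord G c u i (i + 2))
      (b := fun i => NewChord G c u i (i + 3)) ?_ ?_ ?_ ?_ ?_ ?_
    · exact fun i => propext (h.newChord_congr (by push_cast; omega) (by push_cast; omega))
    · exact fun i => propext (h.newChord_congr (by push_cast; omega) (by push_cast; omega))
    · exact fun r hr => two r 2 3 4 (by decide) (k2 r hr.1) (k3 r hr.2)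
    · exact fun r hr => two r 2 4 3 (by decide) (k2 r hr.1) (k4 r hr.2)
    · exact fun r hr => two r 3 4 2 (by decide) (k3 r hr.1) (k4 r hr.2)
    · intro y
      obtain ⟨k, hk⟩ := hch y
      have hkb := h.bounds_of_mem_chords hk
      have hn := (mem_chords.1 hk).2
      have : k = 2 ∨ k = 3 ∨ k = 4 ∨ k = 5 := by omega
      rcases this with rfl | rfl | rfl | rfl
      · exact Or.inl hn
      · exact Or.inr (Or.inl hn)
      · refine Or.inr (Or.inr (Or.inl ?_))
        exact (h.newChord_congr (by push_cast; omega) (by push_cast; omega)).2 hn.symm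
      · refine Or.inr (Or.inr (Or.inr ?_))
        exact (h.newChord_congr (by push_cast; omega) (by push_cast; omega)).2 hn.symm

theorem no_cycle (h : RainbowCycle G c u l) (H : ShortRainbow G c l d) : False := by
  have hd := H.two_le
  rcases Nat.lt_or_ge d 3 with h3 | h3
  · obtain rfl : d = 2 := by omega
    exact h.false_of_two H
  · exact h.false_of_three_le H h3

end RainbowCycle

theorem IndexedPath.exists_rainbowCycle {l : ℕ} {v : ℕ → V} (h : IndexedPath G c v l 0 l)
    (hadj : G.Adj (v l) (v 0)) (hnew : ∀ i < l, c s(v l, v 0) ≠ c s(v i, v (i + 1))) :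
    ∃ u, RainbowCycle G c u l := by
  have hpos : (0 : ℤ) < (l : ℤ) + 1 := by omega
  set f : ℤ → ℕ := fun i => (i % ((l : ℤ) + 1)).toNat with hf
  have hfi : ∀ i, (f i : ℤ) = i % ((l : ℤ) + 1) := fun i =>
    Int.toNat_of_nonneg (Int.emod_nonneg _ hpos.ne')
  have hle : ∀ i, f i ≤ l := by
    intro i
    have := Int.emod_lt_of_pos i hpos
    rw [← hfi] at this
    omega
  have hdvd : ∀ i j, f i = f j → (l : ℤ) + 1 ∣ j - i := by
    intro i j hij
    refine Int.ModEq.dvd (?_ : i % _ = j % _)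
    rw [← hfi, ← hfi, hij]
  have hstep : ∀ i, (f i < l ∧ f (i + 1) = f i + 1) ∨ (f i = l ∧ f (i + 1) = 0) := by
    intro i
    have h1 : (f (i + 1) : ℤ) = ((f i : ℤ) + 1) % ((l : ℤ) + 1) := by
      rw [hfi, hfi, Int.emod_add_emod]
    have h2 := hle i
    rcases h2.lt_or_eq with h3 | h3
    · rw [Int.emod_eq_of_lt (by omega) (by omega)] at h1
      exact Or.inl ⟨h3, by omega⟩
    · rw [h3, Int.emod_self] at h1
      exact Or.inr ⟨h3, by omega⟩
  refine ⟨fun i => v (f i), fun i => ?_, fun i j he => ?_, fun i => ?_, fun i j he => ?_⟩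
  · simp only [hf, Int.add_emod_right]
  · exact hdvd i j (h.inj _ (hle i) _ (hle j) he)
  · rcases hstep i with ⟨h1, h2⟩ | ⟨h1, h2⟩
    · rw [h2]; exact h.adj _ (by omega) h1
    · rw [h1, h2]; exact hadj
  · refine hdvd i j ?_
    rcases hstep i with ⟨h1, h2⟩ | ⟨h1, h2⟩ <;> rcases hstep j with ⟨h3, h4⟩ | ⟨h3, h4⟩ <;>
      simp only [h2, h4] at he
    · exact h.col _ _ (by omega) h1 (by omega) h3 he
    · rw [h3] at he
      exact absurd he.symm (hnew _ h1)
    · rw [h1] at he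
      exact absurd he (hnew _ h3)
    · rw [h1, h3]

theorem ShortRainbow.no_cycle {l d : ℕ} {v : ℕ → V} (H : ShortRainbow G c l d)
    (h : IndexedPath G c v l 0 l) (hadj : G.Adj (v l) (v 0))
    (hnew : ∀ i < l, c s(v l, v 0) ≠ c s(v i, v (i + 1))) : False := by
  obtain ⟨u, hu⟩ := h.exists_rainbowCycle hadj hnew
  exact hu.no_cycle H

/-! ### Twin paths: excluded configurations -/

/-- A path of length `l + 1` on which only the first and the last edge share a color, so that it
becomes rainbow when either end is dropped. -/
structure TwinPath (G : SimpleGraph V) (c : Sym2 V → ℕ) (v : ℕ → V) (l : ℕ) : Prop where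
  inj : ∀ i ≤ l + 1, ∀ j ≤ l + 1, v i = v j → i = j
  adj : ∀ i ≤ l, G.Adj (v i) (v (i + 1))
  col : ∀ i < l, ∀ j < l, c s(v i, v (i + 1)) = c s(v j, v (j + 1)) → i = j
  last : c s(v l, v (l + 1)) = c s(v 0, v 1)

/-- The color `γ` is not used by any of the first `l + 1` steps of `v`, except possibly by step
`j`. -/
def Avail (c : Sym2 V → ℕ) (v : ℕ → V) (l j γ : ℕ) : Prop :=
  ∀ i ≤ l, i ≠ j → γ ≠ c s(v i, v (i + 1))

/-- The color `γ` is not used by any of the first `l + 1` steps of `v`. -/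
def Fresh (c : Sym2 V → ℕ) (v : ℕ → V) (l γ : ℕ) : Prop :=
  ∀ i ≤ l, γ ≠ c s(v i, v (i + 1))

theorem Fresh.avail {v : ℕ → V} {l γ : ℕ} (h : Fresh c v l γ) (j : ℕ) : Avail c v l j γ :=
  fun i hi _ => h i hi

/-- The vertices `v p` and `v a` are joined by an edge of a color that the path does not use. -/
def Chord (G : SimpleGraph V) (c : Sym2 V → ℕ) (v : ℕ → V) (l p a : ℕ) : Prop :=
  G.Adj (v p) (v a) ∧ Fresh c v l (c s(v p, v a))

/-- The vertex `v 0` has a neighbor off `v 0, …, v (l + 1)` along an edge of the color of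
step `j`. -/
def SeesOutside (G : SimpleGraph V) (c : Sym2 V → ℕ) (v : ℕ → V) (l j : ℕ) : Prop :=
  ∃ w, (∀ i ≤ l + 1, w ≠ v i) ∧ G.Adj (v 0) w ∧ c s(v 0, w) = c s(v j, v (j + 1))

namespace TwinPath

variable {v : ℕ → V} {l d : ℕ}

theorem left (h : TwinPath G c v l) : IndexedPath G c v (l + 1) 0 l where
  inj := h.inj
  hi_le := by omega
  adj i _ hi := h.adj i (by omega)
  col i j _ hi _ hj := h.col i hi j hj

/-- The color of a step other than the first and the last one occurs only once. -/
theorem avail_step (h : TwinPath G c v l) {j : ℕ} (hj : 1 ≤ j) (hjl : j < l) :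
    Avail c v l j (c s(v j, v (j + 1))) := by
  intro i hi hij he
  rcases Nat.lt_or_ge i l with hil | hil
  · exact hij (h.col _ hjl _ hil he).symm
  · obtain rfl : i = l := by omega
    rw [h.last] at he
    have := h.col _ hjl 0 (by omega) he
    omega

theorem right (h : TwinPath G c v l) : IndexedPath G c v (l + 1) 1 (l + 1) where
  inj := h.inj
  hi_le := by omega
  adj i _ hi := h.adj i (by omega)
  col i j h1 hi h2 hj he := by
    rcases Nat.lt_or_ge i l with hil | hil
    · by_contra hij
      exact h.avail_step h1 hil j (by omega) (Ne.symm hij) he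
    · rcases Nat.lt_or_ge j l with hjl | hjl
      · by_contra hij
        exact h.avail_step h2 hjl i (by omega) hij he.symm
      · omega

theorem symm_step (v : ℕ → V) {l i : ℕ} (hi : i ≤ l) :
    s(v (l + 1 - i), v (l + 1 - (i + 1))) = s(v (l - i), v (l - i + 1)) := by
  rw [show l + 1 - (i + 1) = l - i by omega, show l + 1 - i = l - i + 1 by omega, Sym2.eq_swap]

theorem symm (h : TwinPath G c v l) : TwinPath G c (fun i => v (l + 1 - i)) l where
  inj i hi j hj he := by
    have := h.inj _ (by omega) _ (by omega) he
    omega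
  adj i hi := by
    have := (h.adj (l - i) (by omega)).symm
    rwa [show l - i + 1 = l + 1 - i by omega, show l - i = l + 1 - (i + 1) by omega] at this
  col i hi j hj he := by
    rw [symm_step v hi.le, symm_step v hj.le] at he
    by_contra hij
    rcases Nat.eq_zero_or_pos i with rfl | hi0
    · rw [Nat.sub_zero, h.last] at he
      have := h.col 0 (by omega) (l - j) (by omega) he
      omega
    · exact h.avail_step (j := l - i) (by omega) (by omega) (l - j) (by omega) (by omega) he
  last := by
    have h1 := symm_step v (le_refl l)
    have h2 := symm_step v (Nat.zero_le l)
    simp only [Nat.sub_self, Nat.zero_add, Nat.sub_zero] at h1 h2 ⊢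
    rw [h1, h2, h.last]

theorem fresh_symm (v : ℕ → V) {l γ : ℕ} :
    Fresh c (fun i => v (l + 1 - i)) l γ ↔ Fresh c v l γ := by
  constructor
  · intro h i hi
    have := h (l - i) (by omega)
    rw [symm_step v (by omega : l - i ≤ l)] at this
    rwa [show l - (l - i) = i by omega] at this
  · intro h i hi
    rw [symm_step v (by omega)]
    exact h _ (by omega)

theorem chord_symm (v : ℕ → V) {l a : ℕ} :
    Chord G c (fun i => v (l + 1 - i)) l 0 a ↔ Chord G c v l (l + 1) (l + 1 - a) := by
  unfold Chord
  rw [fresh_symm]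
  simp

theorem chord_symm' (v : ℕ → V) {l a : ℕ} :
    Chord G c (fun i => v (l + 1 - i)) l (l + 1) a ↔ Chord G c v l 0 (l + 1 - a) := by
  unfold Chord
  rw [fresh_symm]
  simp

/-- The vertex `v 0` cannot be inserted between two consecutive inner vertices: the path
`v 1, …, v a, v 0, v (a + 1), …, v (l + 1)` would be too long. -/
theorem not_insert (h : TwinPath G c v l) (H : ShortRainbow G c l d) {a : ℕ} (ha : 1 ≤ a)
    (hal : a < l) (h1 : G.Adj (v 0) (v a)) (h2 : G.Adj (v 0) (v (a + 1)))
    (hne : c s(v 0, v a) ≠ c s(v 0, v (a + 1)))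
    (f1 : Avail c v l a (c s(v 0, v a))) (f2 : Avail c v l a (c s(v 0, v (a + 1)))) : False := by
  have := h.right.three_runs (a₁ := 1) (b₁ := a) (p₁ := 1) (q₁ := a) (a₂ := 0) (b₂ := 0) (p₂ := 0)
    (q₂ := 0) (a₃ := a + 1) (b₃ := l + 1) (p₃ := a + 1) (q₃ := l + 1) (by omega) (by omega)
    (by omega) (by omega) (by omega) (by omega) (by omega) (by omega) (by omega) h1.symm h2
    (by rwa [Sym2.eq_swap]) (fun i _ _ _ => by rw [Sym2.eq_swap]; exact f1 i (by omega) (by omega))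
    (fun i _ _ _ => f2 i (by omega) (by omega))
  have := H.max _ _ _ _ _ this
  omega

/-- The path is `v 0, …, v b, v (l + 1), v (b + 2), …, v l`; an edge out of it at `v 0` would make
it too long. The next three lemmas have the same reason. -/
theorem not_seesOutside_of_gap (h : TwinPath G c v l) (H : ShortRainbow G c l d) {b j : ℕ}
    (hb : b + 2 ≤ l) (h1 : Chord G c v l (l + 1) b) (h2 : Chord G c v l (l + 1) (b + 2))
    (hne : c s(v (l + 1), v b) ≠ c s(v (l + 1), v (b + 2))) (hj : j = b ∨ j = b + 1) :
    ¬ SeesOutside G c v l j := by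
  rintro ⟨w, hw, hadj, hwc⟩
  have := h.left.three_runs (a₁ := 0) (b₁ := b) (p₁ := 0) (q₁ := b) (a₂ := l + 1) (b₂ := l + 1)
    (p₂ := l + 1) (q₂ := l + 1) (a₃ := b + 2) (b₃ := l) (p₃ := b + 2) (q₃ := l) (by omega)
    (by omega) (by omega) (by omega) (by omega) (by omega) (by omega) (by omega) (by omega)
    h1.1.symm h2.1 (by rwa [Sym2.eq_swap])
    (fun i _ _ _ => by rw [Sym2.eq_swap]; exact h1.2 i (by omega))
    (fun i _ _ _ => h2.2 i (by omega))
  rw [show b - 0 + (l + 1 - (l + 1)) + (l - (b + 2)) + 2 = l by omega] at this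
  refine H.false_of_edge this hadj ?_ ?_
  · rintro ⟨i, hi, rfl⟩
    exact hw i (by omega) rfl
  · rw [hwc]
    rintro (he | he | ⟨i, hi, he⟩)
    · rw [Sym2.eq_swap (a := v b)] at he
      exact h1.2 j (by omega) he.symm
    · exact h2.2 j (by omega) he.symm
    · have := h.col j (by omega) i (by omega) he
      omega

/-- The path is `v 0, …, v b, v (l + 1), v (l - 1), …, v (b + 1)`. -/
theorem not_seesOutside_of_last (h : TwinPath G c v l) (H : ShortRainbow G c l d) {b j : ℕ}
    (hb : b + 1 < l) (h1 : Chord G c v l (l + 1) b) (h2 : Chord G c v l (l + 1) (l - 1))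
    (hne : c s(v (l + 1), v b) ≠ c s(v (l + 1), v (l - 1))) (hj : j = b ∨ j = l - 1) :
    ¬ SeesOutside G c v l j := by
  rintro ⟨w, hw, hadj, hwc⟩
  have := h.left.three_runs (a₁ := 0) (b₁ := b) (p₁ := 0) (q₁ := b) (a₂ := l + 1) (b₂ := l + 1)
    (p₂ := l + 1) (q₂ := l + 1) (a₃ := l - 1) (b₃ := b + 1) (p₃ := b + 1) (q₃ := l - 1) (by omega)
    (by omega) (by omega) (by omega) (by omega) (by omega) (by omega) (by omega) (by omega)
    h1.1.symm h2.1 (by rwa [Sym2.eq_swap])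
    (fun i _ _ _ => by rw [Sym2.eq_swap]; exact h1.2 i (by omega))
    (fun i _ _ _ => h2.2 i (by omega))
  rw [show b - 0 + (l + 1 - (l + 1)) + (l - 1 - (b + 1)) + 2 = l by omega] at this
  refine H.false_of_edge this hadj ?_ ?_
  · rintro ⟨i, hi, rfl⟩
    exact hw i (by omega) rfl
  · rw [hwc]
    rintro (he | he | ⟨i, hi, he⟩)
    · rw [Sym2.eq_swap (a := v b)] at he
      exact h1.2 j (by omega) he.symm
    · exact h2.2 j (by omega) he.symm
    · have := h.col j (by omega) i (by omega) he
      omega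

/-- The path is `v 0, v 2, …, v (l + 1)`. -/
theorem not_seesOutside_one (h : TwinPath G c v l) (H : ShortRainbow G c l d) (hl : 2 ≤ l)
    (h1 : Chord G c v l 0 2) : ¬ SeesOutside G c v l 1 := by
  rintro ⟨w, hw, hadj, hwc⟩
  have := h.right.two_runs (a₁ := 0) (b₁ := 0) (p₁ := 0) (q₁ := 0) (a₂ := 2) (b₂ := l + 1)
    (p₂ := 2) (q₂ := l + 1) (by omega) (by omega) (by omega) (by omega) (by omega) h1.1
    (fun i _ _ _ => h1.2 i (by omega))
  rw [show 0 - 0 + (l + 1 - 2) + 1 = l by omega] at this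
  refine H.false_of_edge this hadj ?_ ?_
  · rintro ⟨i, hi, rfl⟩
    exact hw i (by omega) rfl
  · rw [hwc]
    rintro (he | ⟨i, hi, he⟩)
    · exact h1.2 1 (by omega) he.symm
    · exact h.avail_step (j := 1) (by omega) (by omega) i (by omega) (by omega) he

/-- The path is `v 0, v a, …, v (l + 1), v 2, …, v (a - 1)`. -/
theorem not_seesOutside_one' (h : TwinPath G c v l) (H : ShortRainbow G c l d) {a : ℕ}
    (ha : 3 ≤ a) (hal : a ≤ l) (h1 : Chord G c v l 0 a) (h2 : Chord G c v l (l + 1) 2)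
    (hne : c s(v 0, v a) ≠ c s(v (l + 1), v 2)) : ¬ SeesOutside G c v l 1 := by
  rintro ⟨w, hw, hadj, hwc⟩
  have := h.right.three_runs (a₁ := 0) (b₁ := 0) (p₁ := 0) (q₁ := 0) (a₂ := a) (b₂ := l + 1)
    (p₂ := a) (q₂ := l + 1) (a₃ := 2) (b₃ := a - 1) (p₃ := 2) (q₃ := a - 1) (by omega)
    (by omega) (by omega) (by omega) (by omega) (by omega) (by omega) (by omega) (by omega)
    h1.1 h2.1 hne (fun i _ _ _ => h1.2 i (by omega)) (fun i _ _ _ => h2.2 i (by omega))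
  rw [show 0 - 0 + (l + 1 - a) + (a - 1 - 2) + 2 = l by omega] at this
  refine H.false_of_edge this hadj ?_ ?_
  · rintro ⟨i, hi, rfl⟩
    exact hw i (by omega) rfl
  · rw [hwc]
    rintro (he | he | ⟨i, hi, he⟩)
    · exact h1.2 1 (by omega) he.symm
    · exact h2.2 1 (by omega) he.symm
    · exact h.avail_step (j := 1) (by omega) (by omega) i (by omega) (by omega) he

/-- The paths are `v (l + 1), v b, …, v 0, v l, …, v (b + 1)` and `v (l + 1), v b, …, v l, v 0, …, v
(b - 1)`. -/
theorem color_zero_penultimate_ne (h : TwinPath G c v l) (H : ShortRainbow G c l d) {b j : ℕ}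
    (hb : 2 ≤ b) (hbl : b < l) (h1 : Chord G c v l (l + 1) b) (hadj : G.Adj (v 0) (v l))
    (hj : j = b ∨ j + 1 = b) : c s(v 0, v l) ≠ c s(v j, v (j + 1)) := by
  intro he
  have hav := h.avail_step (j := j) (by omega) (by omega)
  rw [← he] at hav
  rcases hj with rfl | hj
  · have := h.left.three_runs (a₁ := l + 1) (b₁ := l + 1) (p₁ := l + 1) (q₁ := l + 1) (a₂ := j)
      (b₂ := 0) (p₂ := 0) (q₂ := j) (a₃ := l) (b₃ := j + 1) (p₃ := j + 1) (q₃ := l) (by omega)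
      (by omega) (by omega) (by omega) (by omega) (by omega) (by omega) (by omega) (by omega)
      h1.1 hadj (by rw [he]; exact h1.2 j (by omega))
      (fun i _ _ _ => h1.2 i (by omega)) (fun i _ _ _ => hav i (by omega) (by omega))
    have := H.max _ _ _ _ _ this
    omega
  · have hav' : Avail c v l j (c s(v l, v 0)) := by rwa [Sym2.eq_swap]
    have := h.left.three_runs (a₁ := l + 1) (b₁ := l + 1) (p₁ := l + 1) (q₁ := l + 1) (a₂ := b)
      (b₂ := l) (p₂ := b) (q₂ := l) (a₃ := 0) (b₃ := b - 1) (p₃ := 0) (q₃ := b - 1) (by omega)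
      (by omega) (by omega) (by omega) (by omega) (by omega) (by omega) (by omega) (by omega)
      h1.1 hadj.symm (by rw [Sym2.eq_swap (a := v l), he]; exact h1.2 j (by omega))
      (fun i _ _ _ => h1.2 i (by omega)) (fun i _ _ _ => hav' i (by omega) (by omega))
    have := H.max _ _ _ _ _ this
    omega

/-- The path is `v 1, …, v a, v 0, v (l + 1), …, v (a + 1)`. -/
theorem color_ends_ne (h : TwinPath G c v l) (H : ShortRainbow G c l d) {a : ℕ} (ha : 1 ≤ a)
    (hal : a < l) (h1 : Chord G c v l 0 a) (hadj : G.Adj (v 0) (v (l + 1))) :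
    c s(v 0, v (l + 1)) ≠ c s(v a, v (a + 1)) := by
  intro he
  have hav := h.avail_step ha hal
  rw [← he] at hav
  have := h.right.three_runs (a₁ := 1) (b₁ := a) (p₁ := 1) (q₁ := a) (a₂ := 0) (b₂ := 0) (p₂ := 0)
    (q₂ := 0) (a₃ := l + 1) (b₃ := a + 1) (p₃ := a + 1) (q₃ := l + 1) (by omega) (by omega)
    (by omega) (by omega) (by omega) (by omega) (by omega) (by omega) (by omega) h1.1.symm hadj
    (by rw [he, Sym2.eq_swap]; exact h1.2 a (by omega))
    (fun i _ _ _ => by rw [Sym2.eq_swap]; exact h1.2 i (by omega))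
    (fun i _ _ _ => hav i (by omega) (by omega))
  have := H.max _ _ _ _ _ this
  omega

/-- The mirror image of `color_ends_ne`. -/
theorem color_ends_ne' (h : TwinPath G c v l) (H : ShortRainbow G c l d) {b : ℕ} (hb : 1 ≤ b)
    (hbl : b + 1 < l) (h1 : Chord G c v l (l + 1) (b + 1)) (hadj : G.Adj (v 0) (v (l + 1))) :
    c s(v 0, v (l + 1)) ≠ c s(v b, v (b + 1)) := by
  have h2 : Chord G c (fun i => v (l + 1 - i)) l 0 (l - b) := by
    rw [chord_symm]
    rwa [show l + 1 - (l - b) = b + 1 by omega]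
  have := h.symm.color_ends_ne H (by omega) (by omega) h2 (by simpa using hadj.symm)
  rw [symm_step v (by omega), show l - (l - b) = b by omega] at this
  simpa [Sym2.eq_swap] using this

end TwinPath

/-! ### Twin paths: the pattern of new neighbors -/

/-- An element of the block `{2 * j, 2 * j + 1}`: the even one for `j ≤ i`, the odd one
for `i < j`. -/
def blockPos (i j : ℕ) : ℕ := if j ≤ i then 2 * j else 2 * j + 1

/-- The predicate `N` holds at `blockPos i j` for all `j ∈ [1, d]`, and `α` takes distinct values
there. -/
structure IsPattern (N : ℕ → Prop) (α : ℕ → ℕ) (d i : ℕ) : Prop where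
  le : i ≤ d
  mem : ∀ j, 1 ≤ j → j ≤ d → N (blockPos i j)
  inj : ∀ j j', 1 ≤ j → j ≤ d → 1 ≤ j' → j' ≤ d → α (blockPos i j) = α (blockPos i j') → j = j'

/-- If `N ⊆ [2, 2 * d + 1]` carries at least `d` values of `α` and consecutive elements of `N` have
equal values, then each block `{2 * j, 2 * j + 1}` carries exactly one value, and `N` contains one
of the `d + 1` patterns of `d` pairwise non-consecutive positions. -/
theorem exists_isPattern {N : ℕ → Prop} {α : ℕ → ℕ} {d : ℕ} {D : Finset ℕ} (hD : d ≤ D.card)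
    (hsub : ∀ γ ∈ D, ∃ a, 2 ≤ a ∧ a ≤ 2 * d + 1 ∧ N a ∧ α a = γ)
    (hadj : ∀ a, N a → N (a + 1) → α a = α (a + 1)) :
    D.card = d ∧ ∃ i, IsPattern N α d i := by
  classical
  set b : ℕ → ℕ := fun j => if N (2 * j) then α (2 * j) else α (2 * j + 1) with hb
  have hodd : ∀ j, N (2 * j + 1) → b j = α (2 * j + 1) := by
    intro j hj
    by_cases h : N (2 * j)
    · simp only [hb, if_pos h]; exact hadj _ h hj
    · simp only [hb, if_neg h]
  have heven : ∀ j, N (2 * j) → b j = α (2 * j) := fun j hj => by simp only [hb, if_pos hj]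
  have himg : ∀ γ ∈ D, ∃ j ∈ Finset.Icc 1 d, (N (2 * j) ∨ N (2 * j + 1)) ∧ b j = γ := by
    intro γ hγ
    obtain ⟨a, h1, h2, h3, rfl⟩ := hsub γ hγ
    refine ⟨a / 2, Finset.mem_Icc.2 (by omega), ?_⟩
    rcases Nat.even_or_odd' a with ⟨t, rfl | rfl⟩
    · rw [show 2 * t / 2 = t by omega]
      exact ⟨Or.inl h3, heven t h3⟩
    · rw [show (2 * t + 1) / 2 = t by omega]
      exact ⟨Or.inr h3, hodd t h3⟩
  have hsub1 : D ⊆ ((Finset.Icc 1 d).filter fun j => N (2 * j) ∨ N (2 * j + 1)).image b := by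
    intro γ hγ
    obtain ⟨j, h1, h2, h3⟩ := himg γ hγ
    exact Finset.mem_image.2 ⟨j, Finset.mem_filter.2 ⟨h1, h2⟩, h3⟩
  have hc1 := Finset.card_le_card hsub1
  have hc2 := Finset.card_image_le (s := (Finset.Icc 1 d).filter
    fun j => N (2 * j) ∨ N (2 * j + 1)) (f := b)
  have hc3 := Finset.card_filter_le (Finset.Icc 1 d) (fun j => N (2 * j) ∨ N (2 * j + 1))
  rw [Nat.card_Icc, Nat.add_sub_cancel] at hc3
  have hall : (Finset.Icc 1 d).filter (fun j => N (2 * j) ∨ N (2 * j + 1)) = Finset.Icc 1 d :=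
    Finset.eq_of_subset_of_card_le (Finset.filter_subset _ _)
      (by rw [Nat.card_Icc]; omega)
  have hN : ∀ j, 1 ≤ j → j ≤ d → N (2 * j) ∨ N (2 * j + 1) := by
    intro j h1 h2
    have : j ∈ Finset.Icc 1 d := Finset.mem_Icc.2 ⟨h1, h2⟩
    rw [← hall] at this
    exact (Finset.mem_filter.1 this).2
  have hinj : Set.InjOn b (Finset.Icc 1 d : Finset ℕ) := by
    rw [← Finset.card_image_iff]
    rw [hall] at hc1 hc2
    rw [Nat.card_Icc] at hc2 ⊢
    omega
  have hinj' : ∀ j j', 1 ≤ j → j ≤ d → 1 ≤ j' → j' ≤ d → b j = b j' → j = j' := by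
    intro j j' h1 h2 h3 h4 h5
    exact hinj (by simp [h1, h2]) (by simp [h3, h4]) h5
  refine ⟨by omega, ?_⟩
  have key : ∀ m ≤ d, ∃ i ≤ m, ∀ j, 1 ≤ j → j ≤ m → N (blockPos i j) := by
    intro m
    induction m with
    | zero => exact fun _ => ⟨0, le_rfl, fun j h1 h2 => by omega⟩
    | succ m ih =>
      intro hm
      obtain ⟨i, him, hi⟩ := ih (by omega)
      rcases Nat.lt_or_ge i m with hlt | hge
      · refine ⟨i, by omega, fun j h1 h2 => ?_⟩
        rcases Nat.lt_or_ge j (m + 1) with hj | hj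
        · exact hi j h1 (by omega)
        obtain rfl : j = m + 1 := by omega
        have hom : N (2 * m + 1) := by
          have := hi m (by omega) le_rfl
          rwa [blockPos, if_neg (by omega)] at this
        rw [blockPos, if_neg (by omega)]
        refine (hN (m + 1) (by omega) hm).resolve_left fun hev => ?_
        have h3 := hadj (2 * m + 1) hom hev
        have h4 : b m = b (m + 1) := by rw [hodd m hom, heven (m + 1) hev]; exact h3
        have := hinj' m (m + 1) (by omega) (by omega) (by omega) hm h4
        omega
      · obtain rfl : i = m := by omega
        rcases hN (i + 1) (by omega) hm with hev | hod
        · refine ⟨i + 1, le_rfl, fun j h1 h2 => ?_⟩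
          rcases Nat.lt_or_ge j (i + 1) with hj | hj
          · have := hi j h1 (by omega)
            rw [blockPos, if_pos (by omega)] at this ⊢
            exact this
          · obtain rfl : j = i + 1 := by omega
            rwa [blockPos, if_pos le_rfl]
        · refine ⟨i, by omega, fun j h1 h2 => ?_⟩
          rcases Nat.lt_or_ge j (i + 1) with hj | hj
          · exact hi j h1 (by omega)
          · obtain rfl : j = i + 1 := by omega
            rwa [blockPos, if_neg (by omega)]
  obtain ⟨i, hid, hi⟩ := key d le_rfl
  have hbα : ∀ j, 1 ≤ j → j ≤ d → α (blockPos i j) = b j := by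
    intro j h1 h2
    have := hi j h1 h2
    unfold blockPos at this ⊢
    split_ifs at this ⊢
    · exact (heven j this).symm
    · exact (hodd j this).symm
  refine ⟨i, hid, hi, fun j j' h1 h2 h3 h4 h5 => ?_⟩
  rw [hbα j h1 h2, hbα j' h3 h4] at h5
  exact hinj' j j' h1 h2 h3 h4 h5

/-- An edge of a new color from the first vertex of a longest rainbow path leads to an inner
vertex. -/
theorem IndexedPath.exists_of_new {v : ℕ → V} {l d : ℕ} (h : IndexedPath G c v l 0 l)
    (H : ShortRainbow G c l d) {w : V}
    (hadj : G.Adj (v 0) w) (hnew : ∀ i < l, c s(v 0, w) ≠ c s(v i, v (i + 1))) :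
    ∃ a, 2 ≤ a ∧ a < l ∧ w = v a := by
  by_cases hw : ∃ i ≤ l, w = v i
  · obtain ⟨a, hal, rfl⟩ := hw
    refine ⟨a, ?_, ?_, rfl⟩
    · by_contra ha
      have : a = 0 ∨ a = 1 := by omega
      rcases this with rfl | rfl
      · exact G.loopless.irrefl _ hadj
      · exact hnew 0 (by omega) rfl
    · by_contra ha
      obtain rfl : a = l := by omega
      refine H.no_cycle h hadj.symm fun i hi => ?_
      rw [Sym2.eq_swap]
      exact hnew i hi
  · push Not at hw
    exfalso
    have := h.run (a := 0) (b := l) (p := 0) (q := l) (by omega) (by omega) (by omega)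
      (by omega)
    rw [Nat.sub_zero] at this
    refine H.false_of_edge this hadj ?_ ?_
    · rintro ⟨i, hi, rfl⟩
      exact hw i (by omega) rfl
    · rintro ⟨i, hi, he⟩
      exact hnew i (by omega) he

namespace TwinPath

variable {v : ℕ → V} {l d : ℕ}

theorem exists_of_fresh (h : TwinPath G c v l) (H : ShortRainbow G c l d) {w : V}
    (hadj : G.Adj (v 0) w) (hf : Fresh c v l (c s(v 0, w))) : ∃ a, 2 ≤ a ∧ a < l ∧ w = v a :=
  IndexedPath.exists_of_new ⟨fun i hi j hj => h.inj i (by omega) j (by omega), le_rfl, h.left.adj,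
    h.left.col⟩ H hadj fun i hi => hf i hi.le

/-- The vertex `v 0` sees at least `d` new colors, and if it sees no more than that, then it sees
all the colors of the path. -/
theorem exists_new_colors (h : TwinPath G c v l) (H : ShortRainbow G c l d) :
    ∃ D : Finset ℕ, d ≤ D.card ∧
      (∀ γ ∈ D, ∃ a, 2 ≤ a ∧ a < l ∧ Chord G c v l 0 a ∧ c s(v 0, v a) = γ) ∧
      (D.card = d → ∀ j < l, ∃ w, G.Adj (v 0) w ∧ c s(v 0, w) = c s(v j, v (j + 1))) := by
  classical
  obtain ⟨D, hD, hDw⟩ := H.deg (v 0)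
  set E : Finset ℕ := (Finset.range l).image fun i => c s(v i, v (i + 1)) with hE
  have hEc : E.card ≤ l := Finset.card_image_le.trans_eq (Finset.card_range l)
  have h1 := Finset.card_sdiff_add_card_inter D E
  have h2 : (D ∩ E).card ≤ E.card := Finset.card_le_card Finset.inter_subset_right
  refine ⟨D \ E, by omega, ?_, ?_⟩
  · intro γ hγ
    obtain ⟨hγD, hγE⟩ := Finset.mem_sdiff.1 hγ
    obtain ⟨w, hadj, hw⟩ := hDw γ hγD
    have hf : Fresh c v l (c s(v 0, w)) := by
      intro i hi he
      have hne : ∀ i < l, γ ≠ c s(v i, v (i + 1)) := fun i hi he =>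
        hγE (Finset.mem_image.2 ⟨i, Finset.mem_range.2 hi, he.symm⟩)
      rcases Nat.lt_or_ge i l with hil | hil
      · exact hne i hil (hw ▸ he)
      · obtain rfl : i = l := by omega
        rcases Nat.eq_zero_or_pos i with rfl | hpos
        · have := H.max _ _ _ _ _ ((RainbowReach.refl (G := G) (c := c) (v 0)).cons
            (h.adj 0 le_rfl).symm (by simpa using (h.adj 0 le_rfl).ne') (by simp))
          omega
        · rw [h.last] at he
          exact hne 0 hpos (hw ▸ he)
    obtain ⟨a, ha, hal, rfl⟩ := h.exists_of_fresh H hadj hf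
    exact ⟨a, ha, hal, ⟨hadj, hf⟩, hw⟩
  · intro hd j hj
    have hEq : D ∩ E = E := Finset.eq_of_subset_of_card_le Finset.inter_subset_right (by omega)
    have : c s(v j, v (j + 1)) ∈ D ∩ E := by
      rw [hEq]
      exact Finset.mem_image.2 ⟨j, Finset.mem_range.2 hj, rfl⟩
    exact hDw _ (Finset.mem_inter.1 this).1

/-- By `not_insert`, consecutive new neighbors of `v 0` are joined to it by edges of equal colors,
so `exists_isPattern` applies. As there are no more than `d` new colors at `v 0`, it sees all the
colors of the path. -/
theorem exists_pattern (h : TwinPath G c v l) (H : ShortRainbow G c l d) :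
    (∀ j < l, ∃ w, G.Adj (v 0) w ∧ c s(v 0, w) = c s(v j, v (j + 1))) ∧
    ∃ i, IsPattern (fun a => 2 ≤ a ∧ a < l ∧ Chord G c v l 0 a) (fun a => c s(v 0, v a)) d i := by
  obtain ⟨D, h1, h2, h3⟩ := h.exists_new_colors H
  have hle := H.le
  have key : D.card = d ∧ ∃ i, IsPattern (fun a => 2 ≤ a ∧ a < l ∧ Chord G c v l 0 a)
      (fun a => c s(v 0, v a)) d i := by
    refine exists_isPattern h1 ?_ ?_
    · intro γ hγ
      obtain ⟨a, ha, hal, hc, he⟩ := h2 γ hγ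
      exact ⟨a, ha, by omega, ⟨ha, hal, hc⟩, he⟩
    · rintro a ⟨ha, hal, hc⟩ ⟨-, -, hc'⟩
      by_contra hne
      exact h.not_insert H (by omega) hal hc.1 hc'.1 hne (hc.2.avail _) (hc'.2.avail _)
  exact ⟨h3 key.1, key.2⟩

/-- The new neighbors of `v (l + 1)`, in terms of their positions on the path read from `v 0`. -/
theorem exists_pattern' (h : TwinPath G c v l) (H : ShortRainbow G c l d) :
    ∃ i, IsPattern (fun b => 2 ≤ b ∧ b < l ∧ Chord G c v l (l + 1) b)
      (fun b => c s(v (l + 1), v b)) d i := by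
  obtain ⟨D, h1, h2, -⟩ := h.symm.exists_new_colors H
  have hle := H.le
  refine (exists_isPattern (N := fun b => 2 ≤ b ∧ b < l ∧ Chord G c v l (l + 1) b)
    (α := fun b => c s(v (l + 1), v b)) h1 ?_ ?_).2
  · intro γ hγ
    obtain ⟨a, ha, hal, hc, he⟩ := h2 γ hγ
    rw [chord_symm] at hc
    exact ⟨l + 1 - a, by omega, by omega, ⟨by omega, by omega, hc⟩, by simpa using he⟩
  · rintro a ⟨ha, hal, hc⟩ ⟨-, hal', hc'⟩
    by_contra hne
    have e1 : l + 1 - (l - a) = a + 1 := by omega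
    have e2 : l + 1 - (l - a + 1) = a := by omega
    have k1 : Chord G c (fun i => v (l + 1 - i)) l 0 (l - a) := by
      rw [chord_symm, e1]; exact hc'
    have k2 : Chord G c (fun i => v (l + 1 - i)) l 0 (l - a + 1) := by
      rw [chord_symm, e2]; exact hc
    refine h.symm.not_insert H (a := l - a) (by omega) (by omega) k1.1 k2.1 ?_ (k1.2.avail _)
      (k2.2.avail _)
    simp only [e1, e2, Nat.sub_zero]
    exact Ne.symm hne

end TwinPath

/-! ### Twin paths: counting the colors at an end -/

theorem IsPattern.even {N : ℕ → Prop} {α : ℕ → ℕ} {d i j : ℕ} (h : IsPattern N α d i)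
    (h1 : 1 ≤ j) (h2 : j ≤ i) : N (2 * j) := by
  have := h.mem j h1 (h2.trans h.le)
  rwa [blockPos, if_pos h2] at this

theorem IsPattern.odd {N : ℕ → Prop} {α : ℕ → ℕ} {d i j : ℕ} (h : IsPattern N α d i)
    (h1 : i < j) (h2 : j ≤ d) : N (2 * j + 1) := by
  have := h.mem j (by omega) h2
  rwa [blockPos, if_neg (by omega)] at this

theorem IsPattern.ne {N : ℕ → Prop} {α : ℕ → ℕ} {d i j j' a a' : ℕ} (h : IsPattern N α d i)
    (h1 : 1 ≤ j) (h2 : j < j') (h3 : j' ≤ d) (ha : a = blockPos i j) (ha' : a' = blockPos i j') :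
    α a ≠ α a' := by
  subst ha ha'
  intro he
  have := h.inj j j' h1 (by omega) (by omega) h3 he
  omega

namespace TwinPath

variable {v : ℕ → V} {l d : ℕ}

/-- New neighbors of `v 0` and of `v (l + 1)`, in the patterns with parameters `i'` and `i`. -/
structure Patterns (G : SimpleGraph V) (c : Sym2 V → ℕ) (v : ℕ → V) (l d i' i : ℕ) : Prop where
  left : IsPattern (fun a => 2 ≤ a ∧ a < l ∧ Chord G c v l 0 a) (fun a => c s(v 0, v a)) d i'
  right : IsPattern (fun b => 2 ≤ b ∧ b < l ∧ Chord G c v l (l + 1) b)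
    (fun b => c s(v (l + 1), v b)) d i

/-- The steps whose colors the new neighbors of `v (l + 1)` do not exclude from the edges leaving
the path at `v 0`. They only occur for `l = 2 * d + 2`. -/
def IsSlack (l d i j : ℕ) : Prop :=
  l = 2 * d + 2 ∧ (j = 2 * i + 1 ∨ (i < d ∧ j = 2 * i + 2) ∨ (i = d ∧ j = 2 * d))

theorem Patterns.length {i' i : ℕ} (P : Patterns G c v l d i' i) (H : ShortRainbow G c l d) :
    (l = 2 * d + 1 ∧ i' = d ∧ i = d) ∨ l = 2 * d + 2 := by
  have h1 := H.le
  have h2 := H.two_le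
  have h3 := P.left.le
  have h4 := P.right.le
  have h5 := (P.left.mem d (by omega) le_rfl).2.1
  have h6 := (P.right.mem d (by omega) le_rfl).2.1
  unfold blockPos at h5 h6
  split_ifs at h5 h6 <;> omega

/-- Only the colors of slack steps can occur on the edges leaving the path at `v 0`. -/
theorem isSlack_of_seesOutside (h : TwinPath G c v l) (H : ShortRainbow G c l d) {i' i j : ℕ}
    (P : Patterns G c v l d i' i) (hj : 1 ≤ j) (hjl : j < l) (hs : SeesOutside G c v l j) :
    IsSlack l d i j := by
  have hd := H.two_le
  have hi := P.right.le
  have hlen := P.length H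
  by_contra hns
  have gap : ∀ t, 1 ≤ t → t < d → blockPos i (t + 1) = blockPos i t + 2 →
      j = blockPos i t ∨ j = blockPos i t + 1 → False := by
    intro t h1 h2 h3 h4
    have k1 := P.right.mem t h1 h2.le
    have k2 := P.right.mem (t + 1) (by omega) h2
    have k3 := P.right.ne h1 (Nat.lt_succ_self t) h2 rfl rfl
    rw [Nat.succ_eq_add_one, h3] at k3
    rw [h3] at k2
    exact h.not_seesOutside_of_gap H k2.2.1.le k1.2.2 k2.2.2 k3 h4 hs
  have last : blockPos i d = l - 1 → ∀ t, 1 ≤ t → t < d → j = blockPos i t ∨ j = l - 1 →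
      False := by
    intro h0 t h1 h2 h4
    have k1 := P.right.mem t h1 h2.le
    have k2 := P.right.mem d (by omega) le_rfl
    have k3 := P.right.ne h1 h2 le_rfl rfl rfl
    rw [h0] at k2 k3
    refine h.not_seesOutside_of_last H ?_ k1.2.2 k2.2.2 k3 h4 hs
    have : blockPos i t < blockPos i d := by
      unfold blockPos; split_ifs <;> omega
    omega
  have one : 1 ≤ i → j ≠ 1 := by
    rintro h1 rfl
    have k1 := (IsPattern.even P.right le_rfl h1).2.2
    rcases Nat.eq_zero_or_pos i' with rfl | hpos
    · have a1 := IsPattern.odd P.left (j := 1) (by omega) (by omega)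
      have a2 := IsPattern.odd P.left (j := 2) (by omega) (by omega)
      have a3 := P.left.ne (j := 1) (j' := 2) (a := 3) (a' := 5) le_rfl (by omega) hd rfl rfl
      by_cases he : c s(v 0, v 3) = c s(v (l + 1), v 2)
      · refine h.not_seesOutside_one' H (a := 5) (by omega) a2.2.1.le a2.2.2 k1 ?_ hs
        rw [← he]; exact a3.symm
      · exact h.not_seesOutside_one' H (a := 3) (by omega) a1.2.1.le a1.2.2 k1 he hs
    · have a1 := IsPattern.even P.left (j := 1) le_rfl hpos
      exact h.not_seesOutside_one H (by omega) a1.2.2 hs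
  unfold IsSlack at hns
  have hE : ∀ t, t ≤ i → blockPos i t = 2 * t := fun t ht => if_pos ht
  have hO : ∀ t, i < t → blockPos i t = 2 * t + 1 := fun t ht => if_neg (by omega)
  rcases Nat.lt_or_ge j (2 * i) with c1 | c1
  · by_cases j1 : j = 1
    · exact one (by omega) j1
    · have e1 := hE (j / 2) (by omega)
      have e2 := hE (j / 2 + 1) (by omega)
      exact gap (j / 2) (by omega) (by omega) (by omega) (by omega)
  · rcases Nat.lt_or_ge i d with c2 | c2
    · have e0 := hO d c2
      rcases Nat.lt_or_ge (2 * d) j with c3 | c3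
      · exact last (by omega) 1 le_rfl (by omega) (by omega)
      · rcases Nat.lt_or_ge (2 * i) j with c4 | c4
        · have e1 := hO ((j - 1) / 2) (by omega)
          have e2 := hO ((j - 1) / 2 + 1) (by omega)
          exact gap ((j - 1) / 2) (by omega) (by omega) (by omega) (by omega)
        · have e1 := hE i le_rfl
          exact last (by omega) i (by omega) c2 (by omega)
    · have e1 := hE 1 (by omega)
      have e2 := hE d (by omega)
      exact last (by omega) 1 le_rfl (by omega) (by omega)

/-- Where `v 0` finds the color of step `j`: off the path, at an inner vertex outside the pattern,
at `v l`, or at `v (l + 1)`. -/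
theorem source (h : TwinPath G c v l) (H : ShortRainbow G c l d) {i' i j : ℕ}
    (P : Patterns G c v l d i' i) (hj : 1 ≤ j) (hjl : j < l) :
    SeesOutside G c v l j ∨
    (∃ a, 2 ≤ a ∧ a < l ∧ (∀ t, 1 ≤ t → t ≤ d → a ≠ blockPos i' t) ∧
      c s(v 0, v a) = c s(v j, v (j + 1))) ∨
    ((l = 2 * d + 2 ∧ j = 2 * i + 1) ∧ G.Adj (v 0) (v l) ∧ c s(v 0, v l) = c s(v j, v (j + 1))) ∨
    (G.Adj (v 0) (v (l + 1)) ∧ c s(v 0, v (l + 1)) = c s(v j, v (j + 1))) := by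
  obtain ⟨w, hadj, hw⟩ := (h.exists_pattern H).1 j hjl
  by_cases hwv : ∃ a ≤ l + 1, w = v a
  swap
  · push Not at hwv
    exact Or.inl ⟨w, hwv, hadj, hw⟩
  obtain ⟨a, hal, rfl⟩ := hwv
  right
  have hd := H.two_le
  have hi := P.right.le
  have hlen := P.length H
  have h0 : a ≠ 0 := by
    rintro rfl
    exact G.loopless.irrefl _ hadj
  have h1 : a ≠ 1 := by
    rintro rfl
    have := h.col 0 (by omega) j hjl hw
    omega
  rcases Nat.lt_trichotomy a l with hlt | rfl | hgt
  · left
    refine ⟨a, by omega, hlt, ?_, hw⟩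
    rintro t ht htd rfl
    exact (P.left.mem t ht htd).2.2.2 j hjl.le hw
  · right; left
    refine ⟨?_, hadj, hw⟩
    by_contra hne
    have key : ∃ t, 1 ≤ t ∧ t ≤ d ∧ (j = blockPos i t ∨ j + 1 = blockPos i t) := by
      rcases Nat.lt_or_ge (2 * i) j with c1 | c1
      · refine ⟨j / 2, by omega, by omega, ?_⟩
        rw [blockPos, if_neg (by omega)]
        omega
      · refine ⟨(j + 1) / 2, by omega, by omega, ?_⟩
        rw [blockPos, if_pos (by omega)]
        omega
    obtain ⟨t, ht, htd, hjt⟩ := key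
    obtain ⟨k1, k2, k3⟩ := P.right.mem t ht htd
    exact h.color_zero_penultimate_ne H k1 k2 k3 hadj hjt hw
  · obtain rfl : a = l + 1 := by omega
    exact Or.inr (Or.inr ⟨hadj, hw⟩)

/-- The vertex `v 0` sees all the colors of the path. The steps `j ≥ 1` that are not slack number `2
* d` or at least `2 * d - 1`, but apart from `v (l + 1)` only the `d` vertices outside the pattern
can supply their colors. -/
theorem eq_two_and_exists (h : TwinPath G c v l) (H : ShortRainbow G c l d) {i' i : ℕ}
    (P : Patterns G c v l d i' i) : d = 2 ∧ l = 6 ∧ ∃ j, 1 ≤ j ∧ j < l ∧ ¬ IsSlack l d i j ∧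
      G.Adj (v 0) (v (l + 1)) ∧ c s(v 0, v (l + 1)) = c s(v j, v (j + 1)) := by
  classical
  have hd := H.two_le
  have hlen := P.length H
  have hid := P.right.le
  set D : Finset ℕ := (Finset.Icc 1 (l - 1)).filter fun j => ¬ IsSlack l d i j with hD
  have hmem : ∀ j, j ∈ D ↔ (1 ≤ j ∧ j ≤ l - 1) ∧ ¬ IsSlack l d i j := by
    intro j; rw [hD, Finset.mem_filter, Finset.mem_Icc]
  have hcard : (l = 2 * d + 1 → 2 * d ≤ D.card) ∧ 2 * d - 1 ≤ D.card := by
    rcases hlen with ⟨hl, -, -⟩ | hl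
    · have : D = Finset.Icc 1 (l - 1) := by
        ext j
        rw [hmem, Finset.mem_Icc]
        unfold IsSlack
        omega
      rw [this, Nat.card_Icc]
      omega
    · refine ⟨by omega, ?_⟩
      have hsub : Finset.Icc 1 (l - 1) \ {2 * i + 1, if i < d then 2 * i + 2 else 2 * d} ⊆ D := by
        intro j hj
        rw [Finset.mem_sdiff, Finset.mem_Icc, Finset.mem_insert, Finset.mem_singleton] at hj
        rw [hmem]
        refine ⟨hj.1, ?_⟩
        unfold IsSlack
        have := hj.2
        split_ifs at this <;> omega
      have h1 := Finset.card_le_card hsub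
      have h2 := Finset.le_card_sdiff {2 * i + 1, if i < d then 2 * i + 2 else 2 * d}
        (Finset.Icc 1 (l - 1))
      have h3 := Finset.card_le_two (a := 2 * i + 1) (b := if i < d then 2 * i + 2 else 2 * d)
      rw [Nat.card_Icc] at h2
      omega
  -- each block has one vertex outside the pattern, which can supply one color only
  have hsrc : ∀ j, ∃ a, j ∈ D → c s(v 0, v (l + 1)) ≠ c s(v j, v (j + 1)) ∨
      ¬ G.Adj (v 0) (v (l + 1)) → 2 ≤ a ∧ a < l ∧
      (∀ t, 1 ≤ t → t ≤ d → a ≠ blockPos i' t) ∧ c s(v 0, v a) = c s(v j, v (j + 1)) := by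
    intro j
    by_cases hj : j ∈ D
    · obtain ⟨⟨hj1, hj2⟩, hj3⟩ := (hmem j).1 hj
      rcases h.source H P hj1 (by omega) with hs | ⟨a, ha⟩ | hs | hs
      · exact absurd (h.isSlack_of_seesOutside H P hj1 (by omega) hs) hj3
      · exact ⟨a, fun _ _ => ha⟩
      · exact absurd ⟨hs.1.1, Or.inl hs.1.2⟩ hj3
      · exact ⟨0, fun _ h' => absurd hs (by tauto)⟩
    · exact ⟨0, fun h' => absurd h' hj⟩
  choose f hf using hsrc
  have hcount : ∀ E ⊆ D, (∀ j ∈ E, c s(v 0, v (l + 1)) ≠ c s(v j, v (j + 1)) ∨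
      ¬ G.Adj (v 0) (v (l + 1))) → E.card ≤ d := by
    intro E hE hne
    have hmaps : ∀ j ∈ E, f j / 2 ∈ Finset.Icc 1 d := by
      intro j hj
      have := hf j (hE hj) (hne j hj)
      rw [Finset.mem_Icc]
      omega
    have hinj : Set.InjOn (fun j => f j / 2) (E : Set ℕ) := by
      intro j hj j' hj' he
      have k1 := hf j (hE hj) (hne j hj)
      have k2 := hf j' (hE hj') (hne j' hj')
      have hm := Finset.mem_Icc.1 (hmaps j hj)
      have n1 := k1.2.2.1 (f j / 2) hm.1 hm.2
      have n2 := k2.2.2.1 (f j / 2) hm.1 hm.2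
      have he' : f j / 2 = f j' / 2 := he
      have hff : f j = f j' := by
        unfold blockPos at n1 n2
        split_ifs at n1 n2 <;> omega
      have m1 := (hmem j).1 (hE hj)
      have m2 := (hmem j').1 (hE hj')
      refine h.col j (by omega) j' (by omega) ?_
      rw [← k1.2.2.2, ← k2.2.2.2, hff]
    have := Finset.card_le_card_of_injOn _ hmaps hinj
    rwa [Nat.card_Icc, Nat.add_sub_cancel] at this
  by_cases hex : ∃ j ∈ D, c s(v 0, v (l + 1)) = c s(v j, v (j + 1)) ∧ G.Adj (v 0) (v (l + 1))
  · obtain ⟨j, hj, hc, hadj⟩ := hex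
    have m1 := (hmem j).1 hj
    have := hcount (D.erase j) (Finset.erase_subset _ _) fun j' hj' => by
      left
      intro he
      have m2 := (hmem j').1 (Finset.mem_of_mem_erase hj')
      exact Finset.ne_of_mem_erase hj' (h.col j' (by omega) j (by omega) (he.symm.trans hc))
    rw [Finset.card_erase_of_mem hj] at this
    exact ⟨by omega, by omega, j, m1.1.1, by omega, m1.2, hadj, hc⟩
  · have := hcount D subset_rfl fun j hj => by
      by_contra hcon
      exact hex ⟨j, hj, by tauto⟩
    omega

/-- Reading the path backwards replaces the parameter `i` of a pattern by `d - i`. -/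
theorem Patterns.symm {i' i : ℕ} (P : Patterns G c v (2 * d + 2) d i' i) :
    Patterns G c (fun j => v (2 * d + 2 + 1 - j)) (2 * d + 2) d (d - i) (d - i') := by
  have pos : ∀ i j, i ≤ d → 1 ≤ j → j ≤ d →
      2 * d + 2 + 1 - blockPos (d - i) j = blockPos i (d + 1 - j) := by
    intro i j h1 h2 h3
    unfold blockPos
    split_ifs <;> omega
  have pos' : ∀ i j, i ≤ d → 1 ≤ j → j ≤ d → 2 ≤ blockPos i j ∧ blockPos i j < 2 * d + 2 := by
    intro i j h1 h2 h3
    unfold blockPos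
    split_ifs <;> omega
  constructor
  · refine ⟨by omega, fun j h1 h2 => ?_, fun j j' h1 h2 h3 h4 he => ?_⟩
    · rw [chord_symm, pos i j P.right.le h1 h2]
      have := pos' (d - i) j (by omega) h1 h2
      exact ⟨this.1, this.2, (P.right.mem (d + 1 - j) (by omega) (by omega)).2.2⟩
    · simp only [Nat.sub_zero] at he
      rw [pos i j P.right.le h1 h2, pos i j' P.right.le h3 h4] at he
      have := P.right.inj (d + 1 - j) (d + 1 - j') (by omega) (by omega) (by omega) (by omega) he
      omega
  · refine ⟨by omega, fun j h1 h2 => ?_, fun j j' h1 h2 h3 h4 he => ?_⟩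
    · rw [chord_symm', pos i' j P.left.le h1 h2]
      have := pos' (d - i') j (by omega) h1 h2
      exact ⟨this.1, this.2, (P.left.mem (d + 1 - j) (by omega) (by omega)).2.2⟩
    · simp only [Nat.sub_self] at he
      rw [pos i' j P.left.le h1 h2, pos i' j' P.left.le h3 h4] at he
      have := P.left.inj (d + 1 - j) (d + 1 - j') (by omega) (by omega) (by omega) (by omega) he
      omega

/-- The one configuration that survives the counting: `d = 2` and opposite patterns. -/
theorem sources_of_opposite (h : TwinPath G c v 6) (H : ShortRainbow G c 6 2)
    (P : Patterns G c v 6 2 2 0) (hx : c s(v 0, v 7) = c s(v 3, v 4)) :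
    (G.Adj (v 0) (v 6) ∧ c s(v 0, v 6) = c s(v 1, v 2)) ∧ SeesOutside G c v 6 2 := by
  have src : ∀ j, 1 ≤ j → j ≠ 3 → j < 6 → (SeesOutside G c v 6 j ∧ j = 2) ∨
      (c s(v 0, v 3) = c s(v j, v (j + 1)) ∨ c s(v 0, v 5) = c s(v j, v (j + 1))) ∨
      (j = 1 ∧ G.Adj (v 0) (v 6) ∧ c s(v 0, v 6) = c s(v j, v (j + 1))) := by
    intro j h1 h3 h6
    rcases h.source H P h1 h6 with hs | ⟨a, ha, hal, hat, hac⟩ | hs | hs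
    · refine Or.inl ⟨hs, ?_⟩
      have hsl := h.isSlack_of_seesOutside H P h1 h6 hs
      have : j ≠ 1 := by
        rintro rfl
        exact h.not_seesOutside_one H (by omega) (P.left.mem 1 (by omega) (by omega)).2.2 hs
      unfold IsSlack at hsl
      omega
    · have a1 := hat 1 (by omega) (by omega)
      have a2 := hat 2 (by omega) (by omega)
      rw [blockPos, if_pos (by omega)] at a1 a2
      have : a = 3 ∨ a = 5 := by omega
      rcases this with rfl | rfl
      · exact Or.inr (Or.inl (Or.inl hac))
      · exact Or.inr (Or.inl (Or.inr hac))
    · exact Or.inr (Or.inr ⟨by omega, hs.2⟩)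
    · exact absurd (h.col _ (by omega) _ h6 (hx.symm.trans hs.2)) (by omega)
  have ne : ∀ {γ : ℕ} (i j : ℕ), i < 6 → j < 6 → i ≠ j → γ = c s(v i, v (i + 1)) →
      γ ≠ c s(v j, v (j + 1)) := fun i j hi hj hij e1 e2 => hij (h.col i hi j hj (e1.symm.trans e2))
  -- the colors of steps 4 and 5 use up `v 3` and `v 5`
  have main : ∀ j, j ≠ 4 → j ≠ 5 → j < 6 →
      ¬ (c s(v 0, v 3) = c s(v j, v (j + 1)) ∨ c s(v 0, v 5) = c s(v j, v (j + 1))) := by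
    have s4 : c s(v 0, v 3) = c s(v 4, v (4 + 1)) ∨ c s(v 0, v 5) = c s(v 4, v (4 + 1)) := by
      rcases src 4 (by omega) (by omega) (by omega) with ⟨-, s⟩ | s | ⟨s, -⟩
      · omega
      · exact s
      · omega
    have s5 : c s(v 0, v 3) = c s(v 5, v (5 + 1)) ∨ c s(v 0, v 5) = c s(v 5, v (5 + 1)) := by
      rcases src 5 (by omega) (by omega) (by omega) with ⟨-, s⟩ | s | ⟨s, -⟩
      · omega
      · exact s
      · omega
    intro j j4 j5 j6
    rcases s4 with s4 | s4 <;> rcases s5 with s5 | s5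
    · exact absurd s5 (ne 4 5 (by omega) (by omega) (by omega) s4)
    · rintro (s | s)
      · exact ne 4 j (by omega) j6 (Ne.symm j4) s4 s
      · exact ne 5 j (by omega) j6 (Ne.symm j5) s5 s
    · rintro (s | s)
      · exact ne 5 j (by omega) j6 (Ne.symm j5) s5 s
      · exact ne 4 j (by omega) j6 (Ne.symm j4) s4 s
    · exact absurd s5 (ne 4 5 (by omega) (by omega) (by omega) s4)
  constructor
  · rcases src 1 (by omega) (by omega) (by omega) with ⟨-, s⟩ | s | ⟨-, s⟩
    · omega
    · exact absurd s (main 1 (by omega) (by omega) (by omega))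
    · exact s
  · rcases src 2 (by omega) (by omega) (by omega) with ⟨s, -⟩ | s | ⟨s, -⟩
    · exact s
    · exact absurd s (main 2 (by omega) (by omega) (by omega))
    · omega

/-- By `sources_of_opposite` and its mirror image, `w, v 0, v 2, v 1, v 7` followed by `v 3, v 4, v
5` or `v 5, v 4, v 3` is a rainbow path with seven edges, for some `w` off the path. -/
theorem not_opposite (h : TwinPath G c v 6) (H : ShortRainbow G c 6 2)
    (P : Patterns G c v 6 2 2 0) (hx : c s(v 0, v 7) = c s(v 3, v 4)) : False := by
  obtain ⟨-, w, hw, hadjw, hwc⟩ := h.sources_of_opposite H P hx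
  obtain ⟨⟨hadj, h1⟩, -⟩ := h.symm.sources_of_opposite H (Patterns.symm (d := 2) P)
    (by simpa [Sym2.eq_swap] using hx)
  have hadj' : G.Adj (v 7) (v 1) := by simpa using hadj
  have h1' : c s(v 7, v 1) = c s(v 5, v 6) := by simpa [Sym2.eq_swap] using h1
  have k2 := (P.left.mem 1 (by omega) (by omega)).2.2
  have k3 := (P.right.mem 1 (by omega) (by omega)).2.2
  have k5 := (P.right.mem 2 (by omega) (by omega)).2.2
  have k35 := P.right.ne (j := 1) (j' := 2) (a := 3) (a' := 5) le_rfl (by omega) le_rfl rfl rfl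
  rw [blockPos, if_pos (by omega)] at k2
  rw [blockPos, if_neg (by omega)] at k3 k5
  norm_num only at k2 k3 k5 k35
  obtain ⟨a, b, hab, hch, hne⟩ : ∃ a b, ((a = 3 ∧ b = 5) ∨ (a = 5 ∧ b = 3)) ∧
      Chord G c v 6 7 a ∧ c s(v 7, v a) ≠ c s(v 0, v 2) := by
    by_cases he : c s(v 7, v 3) = c s(v 0, v 2)
    · exact ⟨5, 3, by omega, k5, fun he' => k35 (he.trans he'.symm)⟩
    · exact ⟨3, 5, by omega, k3, he⟩
  rw [Sym2.eq_swap] at h1'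
  have hrun := h.left.three_runs (a₁ := 2) (b₁ := 1) (p₁ := 1) (q₁ := 2) (a₂ := 7)
    (b₂ := 7) (p₂ := 7) (q₂ := 7) (a₃ := a) (b₃ := b) (p₃ := 3) (q₃ := 5) (by omega)
    (by omega) hab (by omega) (by omega) (by omega) (by omega) (by omega) (by omega)
    hadj'.symm hch.1 (by rw [h1']; exact (hch.2 5 (by omega)).symm)
    (fun i _ _ hi he => by
      have := h.col 5 (by omega) i (by omega) (h1'.symm.trans he)
      omega)
    (fun i _ _ _ => hch.2 i (by omega))
  have hrun' := hrun.cons k2.1 ?_ ?_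
  · norm_num only at hrun'
    refine H.false_of_edge hrun' hadjw ?_ ?_
    · rintro (he | ⟨i, hi, he⟩)
      · exact hw 0 (by omega) he
      · exact hw i (by omega) he
    · rw [hwc]
      rintro (he | he | he | ⟨i, hi, he⟩)
      · exact k2.2 2 (by omega) he.symm
      · have := h.col 2 (by omega) 5 (by omega) (he.trans h1')
        omega
      · exact hch.2 2 (by omega) he.symm
      · have := h.col 2 (by omega) i (by omega) he
        omega
  · rintro ⟨i, hi, he⟩
    have := h.inj 0 (by omega) i (by omega) he
    omega
  · rintro (he | he | ⟨i, hi, he⟩)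
    · exact k2.2 5 (by omega) (he.trans h1')
    · exact hne he.symm
    · exact k2.2 i (by omega) he

theorem false_of_shortRainbow (h : TwinPath G c v l) (H : ShortRainbow G c l d) : False := by
  obtain ⟨-, i', hl⟩ := h.exists_pattern H
  obtain ⟨i, hr⟩ := h.exists_pattern' H
  have P : Patterns G c v l d i' i := ⟨hl, hr⟩
  obtain ⟨rfl, rfl, j, hj, hj6, hjs, hadj, hjc⟩ := h.eq_two_and_exists H P
  have P' := Patterns.symm (d := 2) P
  obtain ⟨-, -, j', hj', hj6', hjs', -, hjc'⟩ := h.symm.eq_two_and_exists H P'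
  rw [symm_step v (by omega)] at hjc'
  have hjj : j = 6 - j' := by
    by_contra hne
    refine h.avail_step hj hj6 (6 - j') (by omega) (Ne.symm hne) ?_
    rw [← hjc, ← hjc', Sym2.eq_swap]
  have hi := P.right.le
  have hi' := P.left.le
  have left : ∀ t, 1 ≤ t → t ≤ 2 → j ≠ blockPos i' t := by
    rintro t h1 h2 rfl
    obtain ⟨k1, k2, k3⟩ := P.left.mem t h1 h2
    exact h.color_ends_ne H hj hj6 k3 hadj hjc
  have right : ∀ t, 1 ≤ t → t ≤ 2 → j + 1 ≠ blockPos i t := by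
    intro t h1 h2 he
    obtain ⟨k1, k2, k3⟩ := P.right.mem t h1 h2
    rw [← he] at k2 k3
    exact h.color_ends_ne' H hj k2 k3 hadj hjc
  have l1 := left 1 (by omega) (by omega)
  have l2 := left 2 (by omega) (by omega)
  have r1 := right 1 (by omega) (by omega)
  have r2 := right 2 (by omega) (by omega)
  unfold IsSlack at hjs hjs'
  unfold blockPos at l1 l2 r1 r2
  have : i' = 2 ∧ i = 0 ∧ j = 3 := by
    split_ifs at l1 l2 r1 r2 <;> omega
  obtain ⟨rfl, rfl, rfl⟩ := this
  exact h.not_opposite H P hjc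

end TwinPath

/-! ### Existence of twin paths -/

namespace IndexedPath

variable {v : ℕ → V} {l d : ℕ}

theorem reverse (h : IndexedPath G c v l 0 l) : IndexedPath G c (fun i => v (l - i)) l 0 l where
  inj i hi j hj he := by
    have := h.inj _ (by omega) _ (by omega) he
    omega
  hi_le := le_rfl
  adj i _ hi := by
    have := (h.adj (l - (i + 1)) (by omega) (by omega)).symm
    rwa [show l - (i + 1) + 1 = l - i by omega] at this
  col i j _ hi _ hj he := by
    rw [Sym2.eq_swap, Sym2.eq_swap (a := v (l - j)), show l - i = l - (i + 1) + 1 by omega,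
      show l - j = l - (j + 1) + 1 by omega] at he
    have := h.col _ _ (by omega) (by omega) (by omega) (by omega) he
    omega

/-- A new edge from the last vertex to `v j` replaces step `j`; the part after `v j` gets
reversed. -/
theorem rotate (h : IndexedPath G c v l 0 l) {j : ℕ} (hj : j < l) (hadj : G.Adj (v l) (v j))
    (hnew : ∀ i < l, c s(v l, v j) ≠ c s(v i, v (i + 1))) :
    IndexedPath G c (fun i => if i ≤ j then v i else v (l + j + 1 - i)) l 0 l := by
  have key : ∀ i < l, ∃ x y, s((if i ≤ j then v i else v (l + j + 1 - i)),
      (if i + 1 ≤ j then v (i + 1) else v (l + j + 1 - (i + 1)))) = s(x, y) ∧ G.Adj x y ∧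
      ((i = j ∧ x = v l ∧ y = v j) ∨ ∃ k < l, (k = i ∧ i < j ∨ k = l + j - i ∧ j < i) ∧
        x = v k ∧ y = v (k + 1)) := by
    intro i hi
    rcases Nat.lt_trichotomy i j with h1 | rfl | h1
    · refine ⟨v i, v (i + 1), ?_, h.adj i (by omega) hi, Or.inr ⟨i, hi, by omega, rfl, rfl⟩⟩
      rw [if_pos (by omega), if_pos (by omega)]
    · refine ⟨v l, v i, ?_, hadj, Or.inl ⟨rfl, rfl, rfl⟩⟩
      rw [if_pos le_rfl, if_neg (by omega), show l + i + 1 - (i + 1) = l by omega, Sym2.eq_swap]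
    · refine ⟨v (l + j - i), v (l + j - i + 1), ?_, h.adj _ (by omega) (by omega),
        Or.inr ⟨l + j - i, by omega, by omega, rfl, rfl⟩⟩
      rw [if_neg (by omega), if_neg (by omega), show l + j + 1 - i = l + j - i + 1 by omega,
        show l + j + 1 - (i + 1) = l + j - i by omega, Sym2.eq_swap]
  refine ⟨?_, le_rfl, ?_, ?_⟩
  · intro i hi i' hi' he
    split_ifs at he <;>
    · have := h.inj _ (by omega) _ (by omega) he
      omega
  · intro i _ hi
    obtain ⟨x, y, hxy, hadj', -⟩ := key i hi
    rw [← G.mem_edgeSet] at hadj' ⊢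
    rwa [hxy]
  · intro i i' _ hi _ hi' he
    obtain ⟨x, y, hxy, -, hk⟩ := key i hi
    obtain ⟨x', y', hxy', -, hk'⟩ := key i' hi'
    rw [hxy, hxy'] at he
    rcases hk with ⟨rfl, rfl, rfl⟩ | ⟨k, hk, hki, rfl, rfl⟩
    · rcases hk' with ⟨rfl, -, -⟩ | ⟨k', hk', -, rfl, rfl⟩
      · rfl
      · exact absurd he (hnew k' hk')
    · rcases hk' with ⟨rfl, rfl, rfl⟩ | ⟨k', hk', hki', rfl, rfl⟩
      · exact absurd he.symm (hnew k hk)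
      · have := h.col k k' (by omega) hk (by omega) hk' he
        omega

/-- An edge that leaves a rainbow path at its first vertex and repeats the last color gives a twin
path. -/
theorem exists_twinPath_of_adj (h : IndexedPath G c v l 0 l) (hl : 1 ≤ l) {w : V}
    (hw : ∀ i ≤ l, w ≠ v i) (hadj : G.Adj (v 0) w) (hc : c s(v 0, w) = c s(v (l - 1), v l)) :
    ∃ v', TwinPath G c v' l := by
  refine ⟨fun i => if i = 0 then w else v (i - 1), ?_⟩
  have hl' : c s(v (l - 1), v l) = c s(v (l - 1), v (l - 1 + 1)) := by rw [Nat.sub_add_cancel hl]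
  constructor
  · intro i hi j hj he
    split_ifs at he with h1 h2 h2
    · omega
    · exact absurd he (hw _ (by omega))
    · exact absurd he.symm (hw _ (by omega))
    · have := h.inj _ (by omega) _ (by omega) he
      omega
  · intro i hi
    rw [if_neg (by omega : i + 1 ≠ 0), Nat.add_sub_cancel]
    split_ifs with h1
    · subst h1; exact hadj.symm
    · have := h.adj (i - 1) (by omega) (by omega)
      rwa [Nat.sub_add_cancel (by omega)] at this
  · intro i hi j hj he
    rw [if_neg (by omega : i + 1 ≠ 0), if_neg (by omega : j + 1 ≠ 0), Nat.add_sub_cancel,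
      Nat.add_sub_cancel] at he
    have key : ∀ k < l, ∃ k' < l, (k = 0 ∧ k' = l - 1 ∨ k = k' + 1) ∧
        c s((if k = 0 then w else v (k - 1)), v k) = c s(v k', v (k' + 1)) := by
      intro k hk
      split_ifs with h1
      · subst h1
        exact ⟨l - 1, by omega, by omega, by rw [Sym2.eq_swap, hc, hl']⟩
      · exact ⟨k - 1, by omega, by omega, by rw [Nat.sub_add_cancel (by omega)]⟩
    obtain ⟨i', hi', hii, e1⟩ := key i hi
    obtain ⟨j', hj', hjj, e2⟩ := key j hj
    rw [e1, e2] at he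
    have := h.col i' j' (by omega) hi' (by omega) hj' he
    omega
  · rw [if_neg (by omega), if_neg (by omega), if_pos rfl, if_neg (by omega)]
    rw [Nat.add_sub_cancel, Nat.sub_self, Sym2.eq_swap (a := w), hc]

/-- A new neighbor `v j` of the last vertex excludes the color of step `j` from the edges that leave
the path at `v 0`, as the rotated path avoids this color. Counting the colors at `v 0` then leaves
no slack, so that `v 0` is adjacent to `v l`, and the new neighbors of `v l` are the last `d` of the
vertices `v 1, …, v (l - 2)`. -/
theorem exists_color_ends (h : IndexedPath G c v l 0 l) (H : ShortRainbow G c l d)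
    (hno : ∀ v', ¬ TwinPath G c v' l) :
    l = 2 * d + 2 ∧ ∃ i < l, d + 1 ≤ i ∧ c s(v 0, v l) = c s(v i, v (i + 1)) := by
  classical
  have hd := H.two_le
  have hle := H.le
  -- the new neighbors of the last vertex
  set N : Finset ℕ := (Finset.Icc 1 (l - 2)).filter fun j =>
    G.Adj (v l) (v j) ∧ ∀ i < l, c s(v l, v j) ≠ c s(v i, v (i + 1)) with hN
  have memN : ∀ j, j ∈ N ↔ (1 ≤ j ∧ j ≤ l - 2) ∧ G.Adj (v l) (v j) ∧
      ∀ i < l, c s(v l, v j) ≠ c s(v i, v (i + 1)) := by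
    intro j; rw [hN, Finset.mem_filter, Finset.mem_Icc]
  set E : Finset ℕ := (Finset.range l).image fun i => c s(v i, v (i + 1)) with hE
  have hNd : d ≤ N.card := by
    obtain ⟨D, hD, hDw⟩ := H.deg (v l)
    have hEc : E.card ≤ l := Finset.card_image_le.trans_eq (Finset.card_range l)
    have h1 := Finset.le_card_sdiff E D
    have h2 : D \ E ⊆ N.image fun j => c s(v l, v j) := by
      intro γ hγ
      obtain ⟨hγD, hγE⟩ := Finset.mem_sdiff.1 hγ
      obtain ⟨w, hadj, rfl⟩ := hDw γ hγD
      have hnew : ∀ i < l, c s(v l, w) ≠ c s(v i, v (i + 1)) := fun i hi he =>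
        hγE (Finset.mem_image.2 ⟨i, Finset.mem_range.2 hi, he.symm⟩)
      obtain ⟨a, ha, hal, rfl⟩ := h.reverse.exists_of_new H (w := w) (by simpa using hadj) (by
        intro i hi
        rw [Sym2.eq_swap (a := v (l - i)), show l - i = l - (i + 1) + 1 by omega, Nat.sub_zero]
        exact hnew _ (by omega))
      exact Finset.mem_image.2 ⟨l - a, (memN _).2 ⟨by omega, hadj, hnew⟩, rfl⟩
    have h3 := Finset.card_le_card h2
    have h4 := Finset.card_image_le (s := N) (f := fun j => c s(v l, v j))
    omega
  -- the colors of inner steps on the edges that leave the path at the first vertex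
  set I : Finset ℕ := (Finset.Icc 1 (l - 2)).filter fun j =>
    ∃ w, (∀ i ≤ l, w ≠ v i) ∧ G.Adj (v 0) w ∧ c s(v 0, w) = c s(v j, v (j + 1)) with hI
  have memI : ∀ j, j ∈ I ↔ (1 ≤ j ∧ j ≤ l - 2) ∧
      ∃ w, (∀ i ≤ l, w ≠ v i) ∧ G.Adj (v 0) w ∧ c s(v 0, w) = c s(v j, v (j + 1)) := by
    intro j; rw [hI, Finset.mem_filter, Finset.mem_Icc]
  have hdisj : Disjoint I N := by
    rw [Finset.disjoint_left]
    intro j hjI hjN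
    obtain ⟨hj, w, hw, hadj, hwc⟩ := (memI j).1 hjI
    obtain ⟨-, hadj', hnew⟩ := (memN j).1 hjN
    have hr := (h.rotate (by omega) hadj' hnew).run (a := 0) (b := l) (p := 0) (q := l) (by omega)
      (by omega) (by omega) (by omega)
    simp only [Nat.zero_le, if_true, Nat.sub_zero] at hr
    refine H.false_of_edge hr hadj ?_ ?_
    · rintro ⟨i, hi, he⟩
      split_ifs at he
      · exact hw _ (by omega) he
      · exact hw _ (by omega) he
    · rw [hwc]
      rintro ⟨i, hi, he⟩
      rcases Nat.lt_trichotomy i j with h1 | rfl | h1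
      · rw [if_pos (by omega), if_pos (by omega)] at he
        have := h.col _ _ (by omega) (by omega) (by omega) (by omega) he
        omega
      · rw [if_pos (by omega), if_neg (by omega), show l + i + 1 - (i + 1) = l by omega,
          Sym2.eq_swap (b := v l)] at he
        exact hnew i (by omega) he.symm
      · rw [if_neg (by omega), if_neg (by omega), Sym2.eq_swap (b := v (l + j + 1 - (i + 1))),
          show l + j + 1 - i = l + j + 1 - (i + 1) + 1 by omega] at he
        have := h.col _ _ (by omega) (by omega) (by omega) (by omega) he
        omega
  have hsum : I.card + N.card ≤ l - 2 := by
    rw [← Finset.card_union_of_disjoint hdisj]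
    refine (Finset.card_le_card (t := Finset.Icc 1 (l - 2)) ?_).trans_eq (by simp)
    exact Finset.union_subset (Finset.filter_subset _ _) (Finset.filter_subset _ _)
  obtain ⟨D, hD, hDw⟩ := H.deg (v 0)
  set A : Finset ℕ := (Finset.range (l - 1)).image fun i => c s(v 0, v (i + 1)) with hA
  set B : Finset ℕ := I.image fun j => c s(v j, v (j + 1)) with hB
  have hAc : A.card ≤ l - 1 := Finset.card_image_le.trans_eq (Finset.card_range _)
  have hBc : B.card ≤ I.card := Finset.card_image_le
  have hABc := Finset.card_union_le A B
  have hDsub : ∀ γ ∈ D, γ ∈ A ∪ B ∨ (G.Adj (v 0) (v l) ∧ c s(v 0, v l) = γ) := by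
    intro γ hγ
    obtain ⟨w, hadj, rfl⟩ := hDw γ hγ
    by_cases hw : ∃ i ≤ l, w = v i
    · obtain ⟨a, hal, rfl⟩ := hw
      have h0 : a ≠ 0 := by
        rintro rfl
        exact G.loopless.irrefl _ hadj
      rcases Nat.lt_or_ge a l with hlt | hge
      · refine Or.inl (Finset.mem_union_left _ (Finset.mem_image.2 ⟨a - 1, ?_, ?_⟩))
        · rw [Finset.mem_range]; omega
        · rw [Nat.sub_add_cancel (by omega)]
      · obtain rfl : a = l := by omega
        exact Or.inr ⟨hadj, rfl⟩
    · push Not at hw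
      have hnew : ∃ j < l, c s(v 0, w) = c s(v j, v (j + 1)) := by
        by_contra hcon
        push Not at hcon
        obtain ⟨a, -, ha, rfl⟩ := h.exists_of_new H hadj hcon
        exact hw a ha.le rfl
      obtain ⟨j, hjl, hj⟩ := hnew
      have hjl' : j + 1 ≠ l := by
        rintro rfl
        obtain ⟨v', hv'⟩ := h.exists_twinPath_of_adj (by omega) hw hadj (by simpa using hj)
        exact hno v' hv'
      left
      rcases Nat.eq_zero_or_pos j with rfl | hj0
      · exact Finset.mem_union_left _ (Finset.mem_image.2 ⟨0, by rw [Finset.mem_range]; omega,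
          hj.symm⟩)
      · exact Finset.mem_union_right _ (Finset.mem_image.2 ⟨j, (memI j).2
          ⟨by omega, w, hw, hadj, hj⟩, hj.symm⟩)
  have hends : G.Adj (v 0) (v l) ∧ c s(v 0, v l) ∉ A ∪ B := by
    by_contra hcon
    have hsub : D ⊆ A ∪ B := by
      intro γ hγ
      rcases hDsub γ hγ with h1 | ⟨h1, rfl⟩
      · exact h1
      · by_contra h2
        exact hcon ⟨h1, h2⟩
    have := Finset.card_le_card hsub
    omega
  have hDc : D.card ≤ (A ∪ B).card + 1 := by
    have hsub : D ⊆ insert (c s(v 0, v l)) (A ∪ B) := by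
      intro γ hγ
      rcases hDsub γ hγ with h1 | ⟨h1, rfl⟩
      · exact Finset.mem_insert_of_mem h1
      · exact Finset.mem_insert_self _ _
    exact (Finset.card_le_card hsub).trans (Finset.card_insert_le _ _)
  have hl : l = 2 * d + 2 := by omega
  have hcover : ∀ j, 1 ≤ j → j ≤ l - 2 → j ∉ N → j ∈ I := by
    have : I ∪ N = Finset.Icc 1 (l - 2) := by
      refine Finset.eq_of_subset_of_card_le
        (Finset.union_subset (Finset.filter_subset _ _) (Finset.filter_subset _ _)) ?_
      rw [Finset.card_union_of_disjoint hdisj, Nat.card_Icc]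
      omega
    intro j h1 h2 h3
    have hj : j ∈ I ∪ N := by rw [this, Finset.mem_Icc]; omega
    exact (Finset.mem_union.1 hj).resolve_right h3
  -- the rotated paths do not extend to twin paths either
  have hup : ∀ j ∈ N, j + 1 ≤ l - 2 → j + 1 ∈ N := by
    intro j hj hjl
    by_contra hcon
    obtain ⟨-, w, hw, hadj, hwc⟩ := (memI _).1 (hcover (j + 1) (by omega) hjl hcon)
    obtain ⟨hj1, hadj', hnew⟩ := (memN j).1 hj
    obtain ⟨v', hv'⟩ := (h.rotate (by omega) hadj' hnew).exists_twinPath_of_adj (w := w) (by omega)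
      (by
        intro i hi
        split_ifs
        · exact hw _ (by omega)
        · exact hw _ (by omega))
      (by simpa using hadj)
      (by
        rw [if_pos (by omega), if_neg (by omega), if_neg (by omega), hwc, Sym2.eq_swap,
          show l + j + 1 - l = j + 1 by omega, show l + j + 1 - (l - 1) = j + 1 + 1 by omega])
    exact hno v' hv'
  have htop : ∀ j ∈ N, d + 1 ≤ j := by
    intro j hj
    have key : ∀ n, j + n ≤ l - 2 → j + n ∈ N := by
      intro n
      induction n with
      | zero => exact fun _ => hj
      | succ n ih => exact fun hn => hup _ (ih (by omega)) (by omega)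
    have hj1 := ((memN j).1 hj).1
    have hsub : Finset.Icc j (l - 2) ⊆ N := by
      intro i hi
      rw [Finset.mem_Icc] at hi
      have := key (i - j) (by omega)
      rwa [show j + (i - j) = i by omega] at this
    have h1 := Finset.card_le_card hsub
    rw [Nat.card_Icc] at h1
    omega
  refine ⟨hl, ?_⟩
  have hex : ∃ i < l, c s(v 0, v l) = c s(v i, v (i + 1)) := by
    by_contra hcon
    push Not at hcon
    refine H.no_cycle h hends.1.symm fun i hi => ?_
    rw [Sym2.eq_swap]
    exact hcon i hi
  obtain ⟨i, hil, hi⟩ := hex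
  refine ⟨i, hil, ?_, hi⟩
  have hi0 : i ≠ 0 := by
    rintro rfl
    exact hends.2 (Finset.mem_union_left _ (Finset.mem_image.2 ⟨0, by
      rw [Finset.mem_range]; omega, hi.symm⟩))
  by_cases hlast : i = l - 1
  · omega
  · refine htop i ?_
    by_contra hiN
    refine hends.2 (Finset.mem_union_right _ (Finset.mem_image.2 ⟨i, ?_, hi.symm⟩))
    exact hcover i (by omega) (by omega) hiN

/-- Otherwise `exists_color_ends`, applied to the path and its reverse, puts the color of the edge
between the ends into both halves of the path. -/
theorem exists_twinPath (h : IndexedPath G c v l 0 l) (H : ShortRainbow G c l d) :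
    ∃ v', TwinPath G c v' l := by
  by_contra hno
  push Not at hno
  obtain ⟨hl, i, hil, hi, hc⟩ := h.exists_color_ends H hno
  obtain ⟨-, j, hjl, hj, hc'⟩ := h.reverse.exists_color_ends H hno
  rw [Nat.sub_zero, Nat.sub_self, Sym2.eq_swap, Sym2.eq_swap (a := v (l - j)), hc,
    show l - j = l - (j + 1) + 1 by omega] at hc'
  have := h.col i (l - (j + 1)) (by omega) hil (by omega) (by omega) hc'
  omega

end IndexedPath

/-! ### The theorem -/

namespace RainbowReach

variable {u w : V} {S : Set V} {K : Set ℕ} {n : ℕ}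

theorem exists_indexedPath (h : RainbowReach G c u w S K n) :
    ∃ v : ℕ → V, IndexedPath G c v n 0 n := by
  obtain ⟨p, h1, h2, -, -, rfl⟩ := h
  have hp : p.IsPath := Walk.IsPath.mk' h1
  refine ⟨p.getVert, fun i hi j hj he => hp.getVert_injOn hi hj he, le_rfl,
    fun i _ hi => p.adj_getVert_succ hi, fun i j _ hi _ hj he => ?_⟩
  have key : ∀ i (hi : i < (p.edges.map c).length),
      (p.edges.map c)[i] = c s(p.getVert i, p.getVert (i + 1)) := by
    intro i hi
    have hi' : i < p.darts.length := by simpa using hi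
    simp only [Walk.edges, List.getElem_map, Walk.darts_getElem_eq_getVert i hi', Dart.edge_mk]
  rw [← key i (by simpa using hi), ← key j (by simpa using hj)] at he
  exact (h2.getElem_inj_iff).1 he

theorem length_lt [Finite V] (h : RainbowReach G c u w S K n) : n < Nat.card V := by
  obtain ⟨p, h1, -, -, -, rfl⟩ := h
  have := Fintype.ofFinite V
  rw [Nat.card_eq_fintype_card]
  exact Walk.IsPath.length_lt (Walk.IsPath.mk' h1)

end RainbowReach

open Classical in
/-- The colors of the edges as a total function on unordered pairs, with value `0` off the
edges. -/
noncomputable def SimpleGraph.EdgeLabeling.extend (C : G.EdgeLabeling ℕ) (e : Sym2 V) : ℕ :=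
  if h : e ∈ G.edgeSet then C ⟨e, h⟩ else 0

theorem SimpleGraph.EdgeLabeling.extend_coe (C : G.EdgeLabeling ℕ) (e : G.edgeSet) :
    C.extend (e : Sym2 V) = C e := dif_pos e.2

theorem exists_finset_of_le_colorDegree [Finite V] (C : G.EdgeLabeling ℕ) (v : V) {k : ℕ}
    (hk : k ≤ C.colorDegree v) :
    ∃ D : Finset ℕ, k ≤ D.card ∧ ∀ γ ∈ D, ∃ w, G.Adj v w ∧ C.extend s(v, w) = γ := by
  have hfin : (C.colorNeighborhood v).Finite := by
    refine (Set.finite_range C).subset ?_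
    rintro γ ⟨e, -, he⟩
    exact ⟨e, he⟩
  refine ⟨hfin.toFinset, by rwa [← Set.ncard_eq_toFinset_card _ hfin], fun γ hγ => ?_⟩
  obtain ⟨⟨e, he⟩, hv, rfl⟩ := hfin.mem_toFinset.1 hγ
  obtain ⟨w, rfl⟩ := Sym2.mem_iff_exists.1 hv
  exact ⟨w, he, C.extend_coe ⟨_, he⟩⟩

end

theorem theorem2p7 {V : Type*} [Finite V] [Nonempty V] (G : SimpleGraph V)
    (C : G.EdgeLabeling ℕ) (k : ℕ) (hk : 7 ≤ k) (hdeg : ∀ v : V, k ≤ C.colorDegree v) :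
    ∃ (u v : V) (p : G.Walk u v),
      p.IsPath ∧ C.IsHeterochromatic p ∧ ⌈(2 * (k : ℚ)) / 3⌉₊ + 1 ≤ p.length := by
  classical
  set P : ℕ → Prop := fun n => ∃ u w S K, RainbowReach G C.extend u w S K n with hP
  have hP0 : P 0 := ⟨Classical.arbitrary V, _, _, _, RainbowReach.refl _⟩
  have hPlt : ∀ n, P n → n ≤ Nat.card V := fun n ⟨u, w, S, K, h⟩ => h.length_lt.le
  set l := Nat.findGreatest P (Nat.card V) with hl
  have hPl : P l := Nat.findGreatest_spec (Nat.zero_le _) hP0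
  have hmax : ∀ n, P n → n ≤ l := fun n hn => Nat.le_findGreatest (hPlt n hn) hn
  obtain ⟨u, w, S, K, hR⟩ := hPl
  by_cases hlong : ⌈(2 * (k : ℚ)) / 3⌉₊ + 1 ≤ l
  · obtain ⟨p, h1, h2, -, -, h5⟩ := hR
    refine ⟨u, w, p, SimpleGraph.Walk.IsPath.mk' h1, fun e f he hf hne hef => hne ?_, h5 ▸ hlong⟩
    rw [← C.extend_coe, ← C.extend_coe] at hef
    exact Subtype.ext (List.inj_on_of_nodup_map h2 he hf hef)
  · exfalso
    have hlk : 3 * l ≤ 2 * k + 2 := by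
      have h1 : l ≤ ⌈(2 * (k : ℚ)) / 3⌉₊ := by omega
      have h2 : (⌈(2 * (k : ℚ)) / 3⌉₊ : ℚ) < 2 * (k : ℚ) / 3 + 1 :=
        Nat.ceil_lt_add_one (by positivity)
      have h3 : (l : ℚ) ≤ (⌈(2 * (k : ℚ)) / 3⌉₊ : ℚ) := by exact_mod_cast h1
      have h4 : ((3 * l : ℕ) : ℚ) < ((2 * k + 3 : ℕ) : ℚ) := by push_cast; linarith
      have h5 : 3 * l < 2 * k + 3 := by exact_mod_cast h4
      omega
    have H : ShortRainbow G C.extend l (k - l) := by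
      refine ⟨fun u w S K n h => hmax n ⟨u, w, S, K, h⟩, fun v => ?_, by omega, by omega⟩
      rw [Nat.add_sub_cancel' (by omega)]
      exact exists_finset_of_le_colorDegree C v (hdeg v)
    obtain ⟨v, hv⟩ := hR.exists_indexedPath
    obtain ⟨v', hv'⟩ := hv.exists_twinPath H
    exact hv'.false_of_shortRainbow H
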